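/- Let $n\ge 1$. Number the vertices of a regular $(2n+2)$-gon clockwise by $0,1,\dots,2n+1$. A quadrangulation is a set of pairs of distinct non-consecutive vertices (inner edges) that do not cross and cut the polygon into quadrilaterals (squares) only. Colour the vertices alternately white (even) and black (odd), and orient all edges, boundary edges included, from white to black. Fix a quadrangulation $Q$, drawn in the polygon (blue), and draw quadrangulations $R$ in a second copy of the polygon (red), rotated clockwise by $\frac{2\pi}{4n+4}$. Then $R$ is $Q$-compatible if, whenever an edge $i$ of $R$ crosses an edge $j$ of $Q$, the pair $(i,j)$ of oriented edges is positively oriented. A flip between two $Q$-compatible quadrangulations replaces one inner edge by another one. An oriented flip $R\to R'$ is a flip inside a hexagon, with vertices $a_0,b_0,a_1,b_1,a_2,b_2$ in clockwise order ($a_i$ white, $b_i$ black) and whose sides are edges of $R$, that replaces the inner edge $a_2\to b_0$ by $a_0\to b_1$, where some inner edge of $Q$ enters the hexagon through the side $a_2b_1$ and leaves it through the opposite side $a_0b_0$; it is an out-flip for $R$ and an in-flip for $R'$. The Stokes poset $\Gamma_Q$ is the set of $Q$-compatible quadrangulations with $R'\le R$ if $R'$ is reached from $R$ by a sequence of oriented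 flips. Let $C_n$ be the set of inner edges $(0,3),(0,5),\dots,(0,2n-1)$. Then: 1. $C_n$ is a quadrangulation. Planar duality, with the red boundary edge $(2n+1,0)$ as root and the other three sides of each square read clockwise as left, middle and right, is a bijection from the $C_n$-compatible quadrangulations to the rooted planar ternary trees with $n$ nodes and with no middle branch (all middle children are leaves). Hence, forgetting the middle children gives a bijection $f$ to the rooted planar binary trees with $n$ nodes. 2. There is an oriented flip $R\to R'$ if and only if $f(R')$ is obtained from $f(R)$ by one left-to-right rotation $((a\,b)\,c)\to(a\,(b\,c))$ at some node; and $R,R'$ are related by a flip if and only if one of $f(R),f(R')$ is obtained from the other by one such rotation. 3. An inner edge of a $C_n$-compatible quadrangulation $R$ is the one changed by an out-flip (respectively an in-flip) of $R$ if and only if it is dual to a left (respectively right) branch of the tree of $R$. 4. Order the binary trees with $n$ nodes by $s\le t$ if $t$ is obtained from $s$ by a sequence of left-to-right rotations (the Tamari lattice). Then $R\le R'$ in $\Gamma_{C_n}$ if and only if $f(R')\le f(R)$, and the poset $\Gamma_{C_n}$ is isomorphic to the Tamari lattice. In particular $\Gamma_{C_n}$ is a lattice, and it has $\frac{1}{n+1}\binom{2n}{n}$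 elements. -/

import Mathlib

namespace Stokes

/-! ### Quadrangulations

The vertices of the regular polygon with `2 n + 2` vertices are the elements of `Fin (2 * n + 2)`,
numbered in clockwise order; `Fin` addition is cyclic. -/

/-- Strict cyclic order: going clockwise from `x`, one meets `y` strictly before `z`.
For points of a circle (listed clockwise), this says that `y` lies strictly on the left of the
straight line oriented from `x` to `z`. -/
def Cw {α : Type*} [LinearOrder α] (x y z : α) : Prop :=
  (x < y ∧ y < z) ∨ (y < z ∧ z < x) ∨ (z < x ∧ x < y)

/-- The chords `[p, q]` and `[p', q']` of a circle cross in their interiors. -/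
def Crosses {α : Type*} [LinearOrder α] (p q p' q' : α) : Prop :=
  (Cw p p' q ∧ Cw q q' p) ∨ (Cw p q' q ∧ Cw q p' p)

/-- Sets of unordered pairs of vertices of the `(2 n + 2)`-gon. -/
abbrev EdgeSet (n : ℕ) : Type := Set (Sym2 (Fin (2 * n + 2)))

/-- `a` and `b` are joined by a boundary edge of the polygon. -/
def IsBoundary {n : ℕ} (a b : Fin (2 * n + 2)) : Prop := a + 1 = b ∨ b + 1 = a

/-- `a` and `b` are joined by a boundary edge or by an edge of `D`. -/
def IsEdge {n : ℕ} (D : EdgeSet n) (a b : Fin (2 * n + 2)) : Prop :=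
  s(a, b) ∈ D ∨ IsBoundary a b

/-- `a` and `b` are neighbours in the cyclic order on the vertex set `S`. -/
def AdjacentIn {n : ℕ} (S : Finset (Fin (2 * n + 2))) (a b : Fin (2 * n + 2)) : Prop :=
  (∀ c ∈ S, ¬ Cw a c b) ∨ (∀ c ∈ S, ¬ Cw b c a)

/-- `S` is the vertex set of one of the regions cut out by the non-crossing edges `D`: the convex
polygon on `S` has at least three vertices, its sides are edges (boundary edges or edges of `D`),
and no edge is a diagonal of it. -/
def IsRegion {n : ℕ} (D : EdgeSet n) (S : Finset (Fin (2 * n + 2))) : Prop :=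
  3 ≤ S.card ∧ ∀ a ∈ S, ∀ b ∈ S, a ≠ b → (IsEdge D a b ↔ AdjacentIn S a b)

/-- A quadrangulation of the `(2 n + 2)`-gon, given by its set of inner edges: pairs of distinct,
non-consecutive vertices that do not cross and define only quadrilateral regions. -/
structure IsQuadrangulation {n : ℕ} (D : EdgeSet n) : Prop where
  inner : ∀ a b, s(a, b) ∈ D → a ≠ b ∧ ¬ IsBoundary a b
  noncrossing : ∀ a b c d, s(a, b) ∈ D → s(c, d) ∈ D → ¬ Crosses a b c d
  quadrilateral : ∀ S, IsRegion D S → S.card = 4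

/-! ### Compatibility -/

/-- White vertices are the even ones. -/
def IsWhite {n : ℕ} (v : Fin (2 * n + 2)) : Prop := v.val % 2 = 0

/-- Black vertices are the odd ones. -/
def IsBlack {n : ℕ} (v : Fin (2 * n + 2)) : Prop := v.val % 2 = 1

/-- Position of the vertex `v` of the blue polygon among the `4 n + 4` interlaced vertices. -/
def blue {n : ℕ} (v : Fin (2 * n + 2)) : ℕ := 2 * v.val

/-- Position of the vertex `v` of the red polygon, which is the blue polygon rotated clockwise by
half a step. -/
def red {n : ℕ} (v : Fin (2 * n + 2)) : ℕ := 2 * v.val + 1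

/-- Compatibility of the red oriented edge `w → b` with the blue oriented edge `w' → b'`: if they
cross, then (red edge, blue edge) is positively oriented, that is, the blue edge goes from the right
to the left of the red one. -/
def EdgeCompatible {n : ℕ} (w b w' b' : Fin (2 * n + 2)) : Prop :=
  Crosses (red w) (red b) (blue w') (blue b') →
    Cw (red b) (blue w') (red w) ∧ Cw (red w) (blue b') (red b)

/-- The red quadrangulation `R` is `Q`-compatible: every edge of `R` is compatible with every edge
of `Q`, all edges being oriented from white to black. -/
def IsCompatible {n : ℕ} (Q R : EdgeSet n) : Prop :=
  ∀ w b w' b' : Fin (2 * n + 2), IsWhite w → IsBlack b → IsWhite w' → IsBlack b' →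
    IsEdge R w b → IsEdge Q w' b' → EdgeCompatible w b w' b'

/-- The type of `Q`-compatible quadrangulations. -/
def CompatibleQuad {n : ℕ} (Q : EdgeSet n) : Type :=
  {R : EdgeSet n // IsQuadrangulation R ∧ IsCompatible Q R}

/-! ### Flips and the Stokes poset -/

/-- `R` and `R'` are related by a flip: one inner edge is replaced by another one. -/
def IsFlip {n : ℕ} {Q : EdgeSet n} (R R' : CompatibleQuad Q) : Prop :=
  ∃ i ∈ R.1, ∃ j ∉ R.1, R'.1 = insert j (R.1 \ {i})

/-- The oriented flip `R → R'`. The flip takes place in a red hexagon with vertices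
`a₀, b₀, a₁, b₁, a₂, b₂` in clockwise order (`aᵢ` white, `bᵢ` black) whose sides are edges of `R`.
Some long inner edge `w → b` of `Q` enters the hexagon through the side `a₂ b₁` and leaves it through
the opposite side `a₀ b₀`. The inner edge `a₂ → b₀`, which starts on the side where the long edge
enters, is replaced by `a₀ → b₁`, which starts on the side where the long edge leaves. -/
def OrientedFlip {n : ℕ} {Q : EdgeSet n} (R R' : CompatibleQuad Q) : Prop :=
  ∃ a₀ b₀ a₁ b₁ a₂ b₂ : Fin (2 * n + 2),
    (IsWhite a₀ ∧ IsWhite a₁ ∧ IsWhite a₂) ∧ (IsBlack b₀ ∧ IsBlack b₁ ∧ IsBlack b₂) ∧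
    (Cw a₀ b₀ a₁ ∧ Cw a₀ a₁ b₁ ∧ Cw a₀ b₁ a₂ ∧ Cw a₀ a₂ b₂) ∧
    (IsEdge R.1 a₀ b₀ ∧ IsEdge R.1 b₀ a₁ ∧ IsEdge R.1 a₁ b₁ ∧
      IsEdge R.1 b₁ a₂ ∧ IsEdge R.1 a₂ b₂ ∧ IsEdge R.1 b₂ a₀) ∧
    (∃ w b : Fin (2 * n + 2), IsWhite w ∧ IsBlack b ∧ s(w, b) ∈ Q ∧
      Cw (red b₁) (blue w) (red a₂) ∧ Cw (red a₀) (blue b) (red b₀)) ∧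
    s(a₂, b₀) ∈ R.1 ∧ R'.1 = insert s(a₀, b₁) (R.1 \ {s(a₂, b₀)})

/-- The Stokes order is decreasing along oriented flips: `R ≤ R'` if there is a sequence of
oriented flips from `R'` to `R`. -/
instance {n : ℕ} (Q : EdgeSet n) : Preorder (CompatibleQuad Q) where
  le R R' := Relation.ReflTransGen OrientedFlip R' R
  le_refl _ := Relation.ReflTransGen.refl
  le_trans _ _ _ h h' := Relation.ReflTransGen.trans h' h

/-! ### The Catalan quadrangulations -/

/-- The quadrangulation `C_n`, with inner edges `(0,3), (0,5), …, (0,2n-1)`. -/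
def catalanQuad (n : ℕ) : EdgeSet n :=
  {e | ∃ (m : ℕ) (_ : 1 ≤ m) (h : m < n), e = s(0, ⟨2 * m + 1, by omega⟩)}

/-! ### Trees -/

/-- Rooted planar ternary trees. -/
inductive TernaryTree : Type
  | leaf : TernaryTree
  | node : TernaryTree → TernaryTree → TernaryTree → TernaryTree

namespace TernaryTree

/-- Number of inner nodes. -/
def numNodes : TernaryTree → ℕ
  | leaf => 0
  | node l m r => l.numNodes + m.numNodes + r.numNodes + 1

/-- No node has a middle branch: all middle children are leaves. -/
def NoMiddle : TernaryTree → Prop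
  | leaf => True
  | node l m r => m = leaf ∧ l.NoMiddle ∧ r.NoMiddle

/-- The binary tree obtained by forgetting the middle children. -/
def toBinary : TernaryTree → BinaryTree Unit
  | leaf => .nil
  | node l _ r => .node () l.toBinary r.toBinary

end TernaryTree

/-- Planar duality. `IsDual D i j T` says that `T` is the ternary tree dual to the part of the
quadrangulation `D` cut off by the edge `(i, j)`, on the side of the vertices between `i` and `j`,
rooted at this edge. The three other sides of the square next to the edge `(i, j)` are, in clockwise
order, the left, middle and right sides. -/
inductive IsDual {n : ℕ} (D : EdgeSet n) :
    Fin (2 * n + 2) → Fin (2 * n + 2) → TernaryTree → Prop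
  | leaf (i j : Fin (2 * n + 2)) (h : i.val + 1 = j.val) : IsDual D i j .leaf
  | node (i k l j : Fin (2 * n + 2)) (t₁ t₂ t₃ : TernaryTree)
      (hik : i < k) (hkl : k < l) (hlj : l < j) (hs : IsRegion D {i, k, l, j})
      (h₁ : IsDual D i k t₁) (h₂ : IsDual D k l t₂) (h₃ : IsDual D l j t₃) :
      IsDual D i j (.node t₁ t₂ t₃)

/-- `T` is the ternary tree dual to the quadrangulation `D`, rooted at the boundary edge between the
last vertex `2 n + 1` and the vertex `0`. (For a red quadrangulation, this boundary edge is the one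
in front of the blue vertex `0`.) -/
def IsDualTree {n : ℕ} (D : EdgeSet n) (T : TernaryTree) : Prop :=
  IsDual D 0 (Fin.last (2 * n + 1)) T

/-- The inner edge `e` of `D` is dual to a left branch of the dual tree: it is the left side of the
square `i < k < l < j`, whose side nearest to the root is `(i, j)`. -/
def IsLeftBranch {n : ℕ} (D : EdgeSet n) (e : Sym2 (Fin (2 * n + 2))) : Prop :=
  e ∈ D ∧ ∃ i k l j : Fin (2 * n + 2), i < k ∧ k < l ∧ l < j ∧
    IsRegion D {i, k, l, j} ∧ e = s(i, k)

/-- The inner edge `e` of `D` is dual to a right branch of the dual tree: it is the right side of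
the square `i < k < l < j`, whose side nearest to the root is `(i, j)`. -/
def IsRightBranch {n : ℕ} (D : EdgeSet n) (e : Sym2 (Fin (2 * n + 2))) : Prop :=
  e ∈ D ∧ ∃ i k l j : Fin (2 * n + 2), i < k ∧ k < l ∧ l < j ∧
    IsRegion D {i, k, l, j} ∧ e = s(l, j)

/-! ### The Tamari lattice -/

/-- Left-to-right rotation moves `((a b) c) ⟶ (a (b c))` of binary trees, at any node. -/
inductive Rotation : BinaryTree Unit → BinaryTree Unit → Prop
  | root (a b c : BinaryTree Unit) :
      Rotation (.node () (.node () a b) c) (.node () a (.node () b c))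
  | left (a a' b : BinaryTree Unit) (h : Rotation a a') :
      Rotation (.node () a b) (.node () a' b)
  | right (a b b' : BinaryTree Unit) (h : Rotation b b') :
      Rotation (.node () a b) (.node () a b')

/-- Binary trees with `n` inner nodes. -/
def Tamari (n : ℕ) : Type := {t : BinaryTree Unit // t.numNodes = n}

/-- Sum over all nodes of the number of nodes of the left subtree. -/
def leftWeight : BinaryTree Unit → ℕ
  | .nil => 0
  | .node _ a b => leftWeight a + leftWeight b + a.numNodes

theorem Rotation.numNodes_eq {s t : BinaryTree Unit} (h : Rotation s t) :
    s.numNodes = t.numNodes := by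
  induction h <;> simp_all [BinaryTree.numNodes] <;> omega

theorem Rotation.leftWeight_lt {s t : BinaryTree Unit} (h : Rotation s t) :
    leftWeight t < leftWeight s := by
  induction h with
  | root a b c => simp [leftWeight, BinaryTree.numNodes]; omega
  | left a a' b h ih => have := h.numNodes_eq; simp only [leftWeight]; omega
  | right a b b' h ih => simp only [leftWeight]; omega

theorem leftWeight_le_of_reflTransGen {n : ℕ} {s t : Tamari n}
    (h : Relation.ReflTransGen (fun x y : Tamari n => Rotation x.1 y.1) s t) :
    s = t ∨ leftWeight t.1 < leftWeight s.1 := by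
  induction h with
  | refl => exact Or.inl rfl
  | tail _ h ih =>
    have := h.leftWeight_lt
    rcases ih with rfl | ih
    · exact Or.inr this
    · exact Or.inr (this.trans ih)

/-- The Tamari order: `s ≤ t` if `t` is obtained from `s` by a sequence of left-to-right
rotations. -/
instance (n : ℕ) : PartialOrder (Tamari n) where
  le s t := Relation.ReflTransGen (fun x y : Tamari n => Rotation x.1 y.1) s t
  le_refl _ := Relation.ReflTransGen.refl
  le_trans _ _ _ h h' := Relation.ReflTransGen.trans h h'
  le_antisymm s t h h' := by
    rcases leftWeight_le_of_reflTransGen h with h | h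
    · exact h
    · rcases leftWeight_le_of_reflTransGen h' with h' | h'
      · exact h'.symm
      · omega

end Stokes

namespace Stokes

/-! ### Regions of a noncrossing set of edges -/

section Regions

variable {n : ℕ} {D : EdgeSet n}

/-! The blue edges of `catalanQuad n`, with the boundary, join `0` to every odd vertex. An inner red
edge whose smaller end is odd would be crossed by one of them with the wrong sign, so compatibility
means exactly that the smaller end of every inner edge is even and the larger one odd
(`isCompatible_catalanQuad_iff`). Encode the edge `(2 p, 2 q + 1)` as the interval `[p, q]` of `{0,
…, n}`. The square below it has a middle side running from an odd vertex up to an even one. This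
side must be a boundary edge, so the square just splits `[p, q]` into `[p, r]` and `[r + 1, q]`. A
noncrossing family of intervals closed under such splits is the family of spans of the subtrees of
one binary tree: singletons are leaves, `[0, n]` is the root. This gives the bijection
(`exists_eq_quadOf`, `quadOf_injective`) and explains why middle children are leaves. A rotation
exchanges a single span, `[p, s]` for `[r + 1, q]`, inside the hexagon with parts `[p, r]`, `[r + 1,
s]`, `[s + 1, q]`. All long blue edges start at `0`, so they orient every hexagon in the same way,
and oriented flips are rotations (`orientedFlip_iff_exists_rotatesAt`). The third diagonal of the
hexagon has its colours the wrong way round; hence an arbitrary flip is a rotation or its inverse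
(`rotation_or_rotation_of_exchange`). For the lattice property, a tree is recorded by its bracket
vector `reach`. The Tamari order is the pointwise order of these vectors (`tamari_le_iff_reach`),
and the pointwise minimum of two of them is another one (`exists_tree_of_reach`), so meets exist.
Reflection of trees reverses the order; it provides the joins, and an isomorphism of the Stokes
poset with the Tamari lattice itself, not only with its dual. -/

theorem isBoundary_comm {a b : Fin (2 * n + 2)} : IsBoundary a b ↔ IsBoundary b a := by
  unfold IsBoundary; tauto

theorem isBoundary_iff_of_lt {a b : Fin (2 * n + 2)} (h : a < b) :
    IsBoundary a b ↔ a.val + 1 = b.val ∨ (a.val = 0 ∧ b.val = 2 * n + 1) := by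
  unfold IsBoundary
  have ha := a.isLt
  have hb := b.isLt
  rw [Fin.lt_def] at h
  simp only [Fin.ext_iff, Fin.val_add, Fin.val_one]
  have h1 : (a.val + 1) % (2 * n + 2) = a.val + 1 := Nat.mod_eq_of_lt (by omega)
  rw [h1]
  rcases Nat.lt_or_ge (b.val + 1) (2 * n + 2) with hb' | hb'
  · rw [Nat.mod_eq_of_lt hb']; omega
  · have h2 : b.val + 1 = 2 * n + 2 := by omega
    rw [h2, Nat.mod_self]; omega

theorem IsEdge.symm {a b : Fin (2 * n + 2)} (h : IsEdge D a b) : IsEdge D b a := by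
  unfold IsEdge at *
  rwa [Sym2.eq_swap, isBoundary_comm]

theorem isEdge_comm {a b : Fin (2 * n + 2)} : IsEdge D a b ↔ IsEdge D b a :=
  ⟨IsEdge.symm, IsEdge.symm⟩

theorem isEdge_of_succ {a b : Fin (2 * n + 2)} (h : a.val + 1 = b.val) : IsEdge D a b :=
  Or.inr ((isBoundary_iff_of_lt (by rw [Fin.lt_def]; omega)).2 (Or.inl h))

theorem isEdge_zero_last {a b : Fin (2 * n + 2)} (ha : a.val = 0) (hb : b.val = 2 * n + 1) :
    IsEdge D a b :=
  Or.inr ((isBoundary_iff_of_lt (by rw [Fin.lt_def]; omega)).2 (Or.inr ⟨ha, hb⟩))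

theorem adjacentIn_comm {S : Finset (Fin (2 * n + 2))} {a b : Fin (2 * n + 2)} :
    AdjacentIn S a b ↔ AdjacentIn S b a := by
  unfold AdjacentIn; tauto

theorem adjacentIn_iff_of_lt {S : Finset (Fin (2 * n + 2))} {a b : Fin (2 * n + 2)} (h : a < b) :
    AdjacentIn S a b ↔ (∀ c ∈ S, ¬ (a < c ∧ c < b)) ∨ ∀ c ∈ S, a ≤ c ∧ c ≤ b := by
  unfold AdjacentIn Cw
  refine or_congr (forall₂_congr fun c _ => ?_) (forall₂_congr fun c _ => ?_) <;> grind

theorem isRegion_iff {S : Finset (Fin (2 * n + 2))} :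
    IsRegion D S ↔ 3 ≤ S.card ∧ ∀ a ∈ S, ∀ b ∈ S, a < b →
      (IsEdge D a b ↔ (∀ c ∈ S, ¬ (a < c ∧ c < b)) ∨ ∀ c ∈ S, a ≤ c ∧ c ≤ b) := by
  refine and_congr_right fun _ => ⟨fun h a ha b hb hab => ?_, fun h a ha b hb hab => ?_⟩
  · rw [h a ha b hb hab.ne, adjacentIn_iff_of_lt hab]
  · rcases lt_or_gt_of_ne hab with hab | hab
    · rw [h a ha b hb hab, adjacentIn_iff_of_lt hab]
    · rw [isEdge_comm, adjacentIn_comm, h b hb a ha hab, adjacentIn_iff_of_lt hab]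

/-- No two edges, boundary edges included, cross. -/
def Noncrossing (D : EdgeSet n) : Prop :=
  ∀ a b c d, IsEdge D a b → IsEdge D c d → a < c → c < b → b < d → False

theorem noncrossing_of_mem
    (h : ∀ a b c d, s(a, b) ∈ D → s(c, d) ∈ D → a < c → c < b → b < d → False) :
    Noncrossing D := by
  intro a b c d hab hcd h1 h2 h3
  have hd := d.isLt
  rcases hab with hab | hab
  · rcases hcd with hcd | hcd
    · exact h a b c d hab hcd h1 h2 h3
    · rw [isBoundary_iff_of_lt (h2.trans h3)] at hcd
      simp only [Fin.lt_def] at *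
      omega
  · rw [isBoundary_iff_of_lt (h1.trans h2)] at hab
    simp only [Fin.lt_def] at *
    omega

theorem IsQuadrangulation.isNoncrossing (h : IsQuadrangulation D) : Noncrossing D :=
  noncrossing_of_mem fun a b c d hab hcd h1 h2 h3 =>
    h.noncrossing a b c d hab hcd (Or.inl ⟨Or.inl ⟨h1, h2⟩, Or.inr (Or.inr ⟨h1.trans h2, h3⟩)⟩)

/-- The edge with ends `i < j` bounds a region on the side of the vertices between `i` and `j`. -/
theorem Noncrossing.exists_isRegion (hD : Noncrossing D) {i j : Fin (2 * n + 2)}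
    (hij : IsEdge D i j) (hlt : i.val + 1 < j.val) :
    ∃ S, IsRegion D S ∧ i ∈ S ∧ j ∈ S ∧ ∀ c ∈ S, i ≤ c ∧ c ≤ j := by
  classical
  -- the longest edge from `a` ending at or before `b`
  have key : ∀ a b : Fin (2 * n + 2), i ≤ a → a < b → b ≤ j → ∃ c, a < c ∧ c ≤ b ∧
      IsEdge D a c ∧ ¬ (a = i ∧ c = j) ∧
      ∀ y, y ≤ b → IsEdge D a y → a < y → ¬ (a = i ∧ y = j) → y ≤ c := by
    intro a b hia hab hbj
    have hb := b.isLt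
    let F := Finset.univ.filter fun c => a < c ∧ c ≤ b ∧ IsEdge D a c ∧ ¬ (a = i ∧ c = j)
    have hF : F.Nonempty := by
      refine ⟨⟨a.val + 1, by rw [Fin.lt_def] at hab; omega⟩, ?_⟩
      simp only [F, Finset.mem_filter, Finset.mem_univ, true_and]
      refine ⟨?_, ?_, isEdge_of_succ rfl, ?_⟩
      · simp [Fin.lt_def]
      · simp only [Fin.le_def] at *; omega
      · rintro ⟨rfl, h⟩
        have := congrArg Fin.val h
        simp only at this
        omega
    have hm := F.max'_mem hF
    simp only [F, Finset.mem_filter, Finset.mem_univ, true_and] at hm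
    refine ⟨F.max' hF, hm.1, hm.2.1, hm.2.2.1, hm.2.2.2, fun y h1 h2 h3 h4 => ?_⟩
    exact F.le_max' y (by simp only [F, Finset.mem_filter, Finset.mem_univ, true_and]; tauto)
  have hlt' : i < j := by rw [Fin.lt_def]; omega
  -- The vertices visible from the edge `(i, j)`: no other edge within `[i, j]` passes over them.
  let S := Finset.univ.filter fun v => i ≤ v ∧ v ≤ j ∧
    ∀ a b, IsEdge D a b → i ≤ a → a < v → v < b → b ≤ j → a = i ∧ b = j
  have hS : ∀ v, v ∈ S ↔ i ≤ v ∧ v ≤ j ∧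
    ∀ a b, IsEdge D a b → i ≤ a → a < v → v < b → b ≤ j → a = i ∧ b = j := by simp [S]
  have hi : i ∈ S := (hS i).2 ⟨le_rfl, hlt'.le, fun a b _ h1 h2 => absurd h1 h2.not_ge⟩
  have hj : j ∈ S := (hS j).2 ⟨hlt'.le, le_rfl, fun a b _ _ _ h1 h2 => absurd h2 h1.not_ge⟩
  refine ⟨S, isRegion_iff.2 ⟨?_, ?_⟩, hi, hj, fun c hc => ⟨((hS c).1 hc).1, ((hS c).1 hc).2.1⟩⟩
  -- The far end of the longest edge from `i` other than `(i, j)` is visible, and it is the third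
  -- vertex.
  · obtain ⟨c, h1, h2, h3, h4, h5⟩ := key i j le_rfl hlt' le_rfl
    have hcj : c < j := lt_of_le_of_ne h2 fun h => h4 ⟨rfl, h⟩
    have hc : c ∈ S := by
      refine (hS c).2 ⟨h1.le, h2, fun a b hab ha hac hcb hb => ?_⟩
      rcases ha.eq_or_lt with rfl | ha
      · by_contra hne
        exact (h5 b hb hab (hac.trans hcb) hne).not_gt hcb
      · exact (hD _ _ _ _ h3 hab ha hac hcb).elim
    have : ({i, c, j} : Finset (Fin (2 * n + 2))).card = 3 :=
      Finset.card_eq_three.2 ⟨i, c, j, h1.ne, hlt'.ne, hcj.ne, rfl⟩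
    rw [← this]
    refine Finset.card_le_card ?_
    simp [Finset.insert_subset_iff, hi, hc, hj]
  · intro a ha b hb hab
    have ha' := (hS a).1 ha
    have hb' := (hS b).1 hb
    constructor
    · intro he
      by_cases hc : ∃ c ∈ S, a < c ∧ c < b
      · obtain ⟨c, hc, hac, hcb⟩ := hc
        obtain ⟨rfl, rfl⟩ := ((hS c).1 hc).2.2 a b he ha'.1 hac hcb hb'.2.1
        exact Or.inr fun c hc => ⟨((hS c).1 hc).1, ((hS c).1 hc).2.1⟩
      · push Not at hc
        exact Or.inl fun c hcS h => (hc c hcS h.1).not_gt h.2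
    · rintro (h | h)
      -- If the longest edge from `a` stopped before `b`, its far end would be a visible vertex
      -- strictly between `a` and `b`.
      · obtain ⟨c, h1, h2, h3, h4, h5⟩ := key a b ha'.1 hab hb'.2.1
        rcases h2.eq_or_lt with rfl | h2
        · exact h3
        · refine absurd ⟨h1, h2⟩ (h c ((hS c).2 ⟨ha'.1.trans h1.le, h2.le.trans hb'.2.1, ?_⟩))
          intro x y hxy hx hxc hcy hy
          rcases lt_trichotomy x a with hxa | rfl | hax
          · exact ha'.2.2 x y hxy hx hxa (h1.trans hcy) hy
          · rcases le_or_gt y b with hyb | hyb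
            · by_contra hne
              exact (h5 y hyb hxy (h1.trans hcy) hne).not_gt hcy
            · exact hb'.2.2 x y hxy hx hab hyb hy
          · exact (hD _ _ _ _ h3 hxy hax hxc hcy).elim
      · rw [le_antisymm (h i hi).1 ha'.1, ← le_antisymm (h j hj).2 hb'.2.1] at *
        exact hij

/-- The neighbours in `S` of a vertex outside `S`. -/
theorem exists_neighbours {S : Finset (Fin (2 * n + 2))} {i j v : Fin (2 * n + 2)} (hi : i ∈ S)
    (hj : j ∈ S) (hv : v ∉ S) (hiv : i < v) (hvj : v < j) :
    ∃ a ∈ S, ∃ b ∈ S, a < v ∧ v < b ∧ ∀ c ∈ S, c ≤ a ∨ b ≤ c := by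
  have h1 : (S.filter (· < v)).Nonempty := ⟨i, by simp [hi, hiv]⟩
  have h2 : (S.filter (v < ·)).Nonempty := ⟨j, by simp [hj, hvj]⟩
  have ha := Finset.max'_mem _ h1
  have hb := Finset.min'_mem _ h2
  simp only [Finset.mem_filter] at ha hb
  refine ⟨_, ha.1, _, hb.1, ha.2, hb.2, fun c hc => ?_⟩
  rcases lt_trichotomy c v with h | rfl | h
  · exact Or.inl (Finset.le_max' _ _ (by simp [hc, h]))
  · exact absurd hc hv
  · exact Or.inr (Finset.min'_le _ _ (by simp [hc, h]))

/-- If `k` in `S` were missing from `S'`, the side of `S'` passing over `k` would have both ends in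
`S`, as otherwise it would cross a side of `S`. With `k` between its ends it can only be the base
`(i, j)`, which leaves `S'` with two vertices. -/
theorem Noncrossing.region_subset (hD : Noncrossing D) {S S' : Finset (Fin (2 * n + 2))}
    (hS : IsRegion D S) (hS' : IsRegion D S') {i j : Fin (2 * n + 2)} (hi : i ∈ S) (hj : j ∈ S)
    (hi' : i ∈ S') (hj' : j ∈ S') (h : ∀ c ∈ S, i ≤ c ∧ c ≤ j) (h' : ∀ c ∈ S', i ≤ c ∧ c ≤ j) :
    S ⊆ S' := by
  intro k hk
  by_contra hk'
  rw [isRegion_iff] at hS hS'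
  have hik : i < k := lt_of_le_of_ne (h k hk).1 fun e => hk' (e ▸ hi')
  have hkj : k < j := lt_of_le_of_ne (h k hk).2 fun e => hk' (e ▸ hj')
  obtain ⟨v, hv, u, hu, hvk, hku, hvu⟩ := exists_neighbours hi' hj' hk' hik hkj
  have hedge : IsEdge D v u := (hS'.2 v hv u hu (hvk.trans hku)).2
    (Or.inl fun c hc hcc => by
      rcases hvu c hc with e | e
      · exact e.not_gt hcc.1
      · exact e.not_gt hcc.2)
  have hvS : v ∈ S := by
    by_contra hvS
    have hiv : i < v := lt_of_le_of_ne (h' v hv).1 fun e => hvS (e ▸ hi)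
    obtain ⟨x, hx, y, hy, hxv, hvy, hxy⟩ := exists_neighbours hi hj hvS hiv (hvk.trans hkj)
    have hyk : y ≤ k := (hxy k hk).resolve_left fun e => (hxv.trans hvk).not_ge e
    refine hD x y v u ((hS.2 x hx y hy (hxv.trans hvy)).2 (Or.inl fun c hc hcc => ?_)) hedge hxv hvy
      (hyk.trans_lt hku)
    rcases hxy c hc with e | e
    · exact e.not_gt hcc.1
    · exact e.not_gt hcc.2
  have huS : u ∈ S := by
    by_contra huS
    have huj : u < j := lt_of_le_of_ne (h' u hu).2 fun e => huS (e ▸ hj)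
    obtain ⟨x, hx, y, hy, hxu, huy, hxy⟩ := exists_neighbours hi hj huS (hik.trans hku) huj
    have hkx : k ≤ x := (hxy k hk).resolve_right fun e => (hku.trans huy).not_ge e
    refine hD v u x y hedge ((hS.2 x hx y hy (hxu.trans huy)).2 (Or.inl fun c hc hcc => ?_))
      (hvk.trans_le hkx) hxu huy
    rcases hxy c hc with e | e
    · exact e.not_gt hcc.1
    · exact e.not_gt hcc.2
  rcases (hS.2 v hvS u huS (hvk.trans hku)).1 hedge with e | e
  · exact e k hk ⟨hvk, hku⟩
  · have hvi : v = i := le_antisymm (e i hi).1 (h v hvS).1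
    have huj : u = j := le_antisymm (h u huS).2 (e j hj).2
    have hsub : S' ⊆ {i, j} := by
      intro c hc
      have := h' c hc
      subst hvi huj
      rcases hvu c hc with e | e
      · simp [le_antisymm e this.1]
      · simp [le_antisymm this.2 e]
    have := (Finset.card_le_card hsub).trans Finset.card_le_two
    omega

/-- A region is determined by its first and last vertices. -/
theorem Noncrossing.region_unique (hD : Noncrossing D) {S S' : Finset (Fin (2 * n + 2))}
    (hS : IsRegion D S) (hS' : IsRegion D S') {i j : Fin (2 * n + 2)} (hi : i ∈ S) (hj : j ∈ S)
    (hi' : i ∈ S') (hj' : j ∈ S') (h : ∀ c ∈ S, i ≤ c ∧ c ≤ j) (h' : ∀ c ∈ S', i ≤ c ∧ c ≤ j) :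
    S = S' :=
  (hD.region_subset hS hS' hi hj hi' hj' h h').antisymm
    (hD.region_subset hS' hS hi' hj' hi hj h' h)

theorem isRegion_square_iff {i k l j : Fin (2 * n + 2)} (hik : i < k) (hkl : k < l) (hlj : l < j) :
    IsRegion D {i, k, l, j} ↔ (IsEdge D i k ∧ IsEdge D k l ∧ IsEdge D l j ∧ IsEdge D i j) ∧
      ¬ IsEdge D i l ∧ ¬ IsEdge D k j := by
  have hcard : ({i, k, l, j} : Finset (Fin (2 * n + 2))).card = 4 := by
    rw [Finset.card_eq_succ]
    refine ⟨i, {k, l, j}, ?_, rfl, Finset.card_eq_three.2 ⟨k, l, j, hkl.ne, (hkl.trans hlj).ne,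
      hlj.ne, rfl⟩⟩
    simp [hik.ne, (hik.trans hkl).ne, (hik.trans (hkl.trans hlj)).ne]
  rw [isRegion_iff, hcard]
  simp only [Finset.mem_insert, Finset.mem_singleton, forall_eq_or_imp, forall_eq]
  grind

theorem square_unique (hD : Noncrossing D) {i k l j k' l' : Fin (2 * n + 2)}
    (hik : i < k) (hkl : k < l) (hlj : l < j) (hik' : i < k') (hkl' : k' < l') (hlj' : l' < j)
    (h : IsRegion D {i, k, l, j}) (h' : IsRegion D {i, k', l', j}) : k = k' ∧ l = l' := by
  have e := hD.region_unique h h' (i := i) (j := j) (by simp) (by simp) (by simp) (by simp)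
    (by simp; grind) (by simp; grind)
  have h1 : k ∈ ({i, k', l', j} : Finset (Fin (2 * n + 2))) := e ▸ by simp
  have h2 : l ∈ ({i, k', l', j} : Finset (Fin (2 * n + 2))) := e ▸ by simp
  simp only [Finset.mem_insert, Finset.mem_singleton] at h1 h2
  grind

theorem IsQuadrangulation.exists_square (hD : IsQuadrangulation D) {i j : Fin (2 * n + 2)}
    (hij : IsEdge D i j) (hlt : i.val + 1 < j.val) :
    ∃ k l, i < k ∧ k < l ∧ l < j ∧ IsRegion D {i, k, l, j} := by
  obtain ⟨S, hS, hi, hj, h⟩ := hD.isNoncrossing.exists_isRegion hij hlt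
  have hij' : i ≠ j := fun e => by subst e; omega
  have hc : ((S.erase i).erase j).card = 2 := by
    rw [Finset.card_erase_of_mem (by simp [hj, hij'.symm]), Finset.card_erase_of_mem hi,
      hD.quadrilateral S hS]
  have hSe : S = insert i (insert j ((S.erase i).erase j)) := by
    rw [Finset.insert_erase (by simp [hj, hij'.symm]), Finset.insert_erase hi]
  obtain ⟨k, l, hkl, e⟩ := Finset.card_eq_two.1 hc
  have hk : k ∈ (S.erase i).erase j := e ▸ by simp
  have hl : l ∈ (S.erase i).erase j := e ▸ by simp
  simp only [Finset.mem_erase] at hk hl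
  rw [e] at hSe
  have hk' := h k hk.2.2
  have hl' := h l hl.2.2
  rcases lt_or_gt_of_ne hkl with hlt | hlt
  · refine ⟨k, l, lt_of_le_of_ne hk'.1 (Ne.symm hk.2.1), hlt, lt_of_le_of_ne hl'.2 hl.1, ?_⟩
    convert hS using 1
    rw [hSe]; ext; simp; tauto
  · refine ⟨l, k, lt_of_le_of_ne hl'.1 (Ne.symm hl.2.1), hlt, lt_of_le_of_ne hk'.2 hk.1, ?_⟩
    convert hS using 1
    rw [hSe]; ext; simp; tauto

end Regions

end Stokes

namespace Stokes

/-! ### Compatibility with the Catalan quadrangulation -/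

section Compatibility

variable {n : ℕ} {D : EdgeSet n}

/-- By induction on the length: the square below the edge writes it as a sum of three shorter odd
lengths. -/
theorem IsQuadrangulation.odd_sub (hD : IsQuadrangulation D) {a b : Fin (2 * n + 2)}
    (hab : IsEdge D a b) (hlt : a < b) : (b.val - a.val) % 2 = 1 := by
  induction hm : b.val - a.val using Nat.strong_induction_on generalizing a b with
  | _ m ih =>
    rw [Fin.lt_def] at hlt
    by_cases h : a.val + 1 = b.val
    · omega
    · obtain ⟨k, l, hak, hkl, hlb, hS⟩ := hD.exists_square hab (by omega)
      obtain ⟨⟨h1, h2, h3, -⟩, -⟩ := (isRegion_square_iff hak hkl hlb).1 hS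
      rw [Fin.lt_def] at hak hkl hlb
      have e1 := ih _ (by omega) h1 hak rfl
      have e2 := ih _ (by omega) h2 hkl rfl
      have e3 := ih _ (by omega) h3 hlb rfl
      omega

/-- Every edge goes clockwise from its white to its black end, except for the boundary edges. -/
def EdgesClockwise (D : EdgeSet n) : Prop :=
  ∀ a b, s(a, b) ∈ D → a < b → a.val % 2 = 0 ∧ b.val % 2 = 1

theorem isEdge_catalanQuad_zero {b : Fin (2 * n + 2)} (hb : IsBlack b) :
    IsEdge (catalanQuad n) 0 b := by
  have h1 := b.isLt
  unfold IsBlack at hb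
  rcases Nat.lt_or_ge 1 b.val with h | h
  · rcases Nat.lt_or_ge b.val (2 * n + 1) with h' | h'
    · refine Or.inl ⟨b.val / 2, by omega, by omega, ?_⟩
      congr 2
      exact Fin.ext (by simp only; omega)
    · exact isEdge_zero_last (by simp) (by omega)
  · exact isEdge_of_succ (by simp; omega)

theorem isEdge_catalanQuad {w b : Fin (2 * n + 2)} (hw : IsWhite w) (hb : IsBlack b)
    (h : IsEdge (catalanQuad n) w b) : w.val = 0 ∨ w.val = b.val + 1 ∨ b.val = w.val + 1 := by
  unfold IsWhite at hw
  unfold IsBlack at hb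
  rcases h with ⟨m, hm1, hm2, e⟩ | h
  · rw [Sym2.eq_iff] at e
    rcases e with ⟨rfl, rfl⟩ | ⟨rfl, rfl⟩
    · simp
    · simp at hb
  · rcases lt_or_ge w b with hlt | hle
    · rw [isBoundary_iff_of_lt hlt] at h
      omega
    · have hlt : b < w := lt_of_le_of_ne hle (by rintro rfl; omega)
      rw [isBoundary_comm, isBoundary_iff_of_lt hlt] at h
      omega

theorem isCompatible_catalanQuad_iff (hD : IsQuadrangulation D) :
    IsCompatible (catalanQuad n) D ↔ EdgesClockwise D := by
  constructor
  · intro h a b hab hlt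
    have hodd := hD.odd_sub (Or.inl hab) hlt
    have hnb := (hD.inner a b hab).2
    rw [isBoundary_iff_of_lt hlt] at hnb
    rw [Fin.lt_def] at hlt
    have hb := b.isLt
    by_contra hne
    -- The black blue vertex `a + 2` lies between the red vertices `a` and `b`, since `b` is at
    -- least `a + 3`; the blue edge from `0` to it crosses the red edge `b → a` with the wrong sign.
    have hc := h b a 0 ⟨a.val + 2, by omega⟩ (by unfold IsWhite; omega) (by unfold IsBlack; omega)
      (by simp [IsWhite]) (by simp only [IsBlack]; omega) (IsEdge.symm (Or.inl hab))
      (isEdge_catalanQuad_zero (by simp only [IsBlack]; omega))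
    simp only [EdgeCompatible, Crosses, Cw, red, blue, Fin.val_zero] at hc
    omega
  -- A blue edge from `0` comes from outside the clockwise arc from `w` to `b`, which is the right
  -- sign. Any other blue edge cuts off a single red vertex, whose colour decides the sign.
  · intro h w b w' b' hw hb hw' hb' hwb hwb' hc
    have e := isEdge_catalanQuad hw' hb' hwb'
    have e' : w.val < b.val ∨ w.val = b.val + 1 := by
      unfold IsWhite at hw
      unfold IsBlack at hb
      rcases lt_or_ge w b with hlt | hle
      · exact Or.inl hlt
      · have hlt : b < w := lt_of_le_of_ne hle (by rintro rfl; omega)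
        rcases hwb with hwb | hwb
        · have := h b w (by rwa [Sym2.eq_swap]) hlt
          omega
        · rw [isBoundary_comm, isBoundary_iff_of_lt hlt] at hwb
          omega
    simp only [IsWhite, IsBlack, Crosses, Cw, red, blue] at *
    omega

theorem EdgesClockwise.parity (h : EdgesClockwise D) {a b : Fin (2 * n + 2)} (hab : IsEdge D a b)
    (hlt : a.val + 1 < b.val) : a.val % 2 = 0 ∧ b.val % 2 = 1 := by
  rcases hab with hab | hab
  · exact h a b hab (by rw [Fin.lt_def]; omega)
  · rw [isBoundary_iff_of_lt (by rw [Fin.lt_def]; omega)] at hab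
    omega

end Compatibility

/-! ### Binary trees as families of intervals of leaves -/

section Spans

/-- The leaves of the binary tree `t` are numbered from left to right, starting with `o`.
`IsSpan t o a b` says that the leaves `a, …, b` are those below some node (or leaf) of `t`. -/
def IsSpan : BinaryTree Unit → ℕ → ℕ → ℕ → Prop
  | .nil, o, a, b => a = o ∧ b = o
  | .node _ l r, o, a, b => (a = o ∧ b = o + (l.numNodes + r.numNodes + 1)) ∨
      IsSpan l o a b ∨ IsSpan r (o + l.numNodes + 1) a b

theorem IsSpan.bounds {t : BinaryTree Unit} {o a b : ℕ} (h : IsSpan t o a b) :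
    o ≤ a ∧ a ≤ b ∧ b ≤ o + t.numNodes := by
  induction t generalizing o with
  | nil => simp only [IsSpan] at h; simp [BinaryTree.numNodes]; omega
  | node _ l r ihl ihr =>
    simp only [IsSpan] at h
    simp only [BinaryTree.numNodes]
    rcases h with h | h | h
    · omega
    · have := ihl h; omega
    · have := ihr h; omega

theorem isSpan_root (t : BinaryTree Unit) (o : ℕ) : IsSpan t o o (o + t.numNodes) := by
  cases t with
  | nil => simp [IsSpan, BinaryTree.numNodes]
  | node _ l r => simp [IsSpan, BinaryTree.numNodes]

theorem isSpan_leaf {t : BinaryTree Unit} {o a : ℕ} (h : o ≤ a) (h' : a ≤ o + t.numNodes) :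
    IsSpan t o a a := by
  induction t generalizing o with
  | nil => simp only [IsSpan, BinaryTree.numNodes] at *; omega
  | node _ l r ihl ihr =>
    simp only [BinaryTree.numNodes] at h'
    rcases Nat.lt_or_ge (o + l.numNodes) a with e | e
    · exact Or.inr (Or.inr (ihr (by omega) (by omega)))
    · exact Or.inr (Or.inl (ihl h e))

theorem isSpan_node_left {l r : BinaryTree Unit} {o a b : ℕ} (h : b ≤ o + l.numNodes) :
    IsSpan (.node () l r) o a b ↔ IsSpan l o a b := by
  refine ⟨fun h' => ?_, fun h' => Or.inr (Or.inl h')⟩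
  rcases h' with h' | h' | h'
  · omega
  · exact h'
  · have := h'.bounds; omega

theorem isSpan_node_right {l r : BinaryTree Unit} {o a b : ℕ} (h : o + l.numNodes + 1 ≤ a) :
    IsSpan (.node () l r) o a b ↔ IsSpan r (o + l.numNodes + 1) a b := by
  refine ⟨fun h' => ?_, fun h' => Or.inr (Or.inr h')⟩
  rcases h' with h' | h' | h'
  · omega
  · have := h'.bounds; omega
  · exact h'

theorem isSpan_node_across {l r : BinaryTree Unit} {o a b : ℕ} (h : a ≤ o + l.numNodes)
    (h' : o + l.numNodes < b) :
    IsSpan (.node () l r) o a b ↔ a = o ∧ b = o + (l.numNodes + r.numNodes + 1) := by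
  refine ⟨fun h' => ?_, Or.inl⟩
  rcases h' with h' | h' | h'
  · exact h'
  · have := h'.bounds; omega
  · have := h'.bounds; omega

theorem IsSpan.exists_split {t : BinaryTree Unit} {o a b : ℕ} (h : IsSpan t o a b) (hab : a < b) :
    ∃ r, a ≤ r ∧ r < b ∧ IsSpan t o a r ∧ IsSpan t o (r + 1) b := by
  induction t generalizing o with
  | nil => simp only [IsSpan] at h; omega
  | node _ l r ihl ihr =>
    rcases h with ⟨rfl, rfl⟩ | h | h
    · refine ⟨a + l.numNodes, by omega, by omega, Or.inr (Or.inl (isSpan_root l a)),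
        Or.inr (Or.inr ?_)⟩
      convert isSpan_root r (a + l.numNodes + 1) using 1
      omega
    · obtain ⟨s, h1, h2, h3, h4⟩ := ihl h
      exact ⟨s, h1, h2, Or.inr (Or.inl h3), Or.inr (Or.inl h4)⟩
    · obtain ⟨s, h1, h2, h3, h4⟩ := ihr h
      exact ⟨s, h1, h2, Or.inr (Or.inr h3), Or.inr (Or.inr h4)⟩

/-- Spans that share a leaf are nested. The case `c = b` belongs here: the edges `(2 a, 2 b + 1)`
and `(2 c, 2 d + 1)` still cross then if `b < d`. -/
theorem IsSpan.noncrossing {t : BinaryTree Unit} {o a b c d : ℕ} (h : IsSpan t o a b)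
    (h' : IsSpan t o c d) (hac : a < c) (hcb : c ≤ b) : d ≤ b := by
  induction t generalizing o with
  | nil => simp only [IsSpan] at h h'; omega
  | node _ l r ihl ihr =>
    rcases h with h | h | h <;> rcases h' with h' | h' | h'
    · omega
    · have := h'.bounds; omega
    · have := h'.bounds; omega
    · have := h.bounds; omega
    · exact ihl h h'
    · have := h.bounds; have := h'.bounds; omega
    · have := h.bounds; omega
    · have := h.bounds; have := h'.bounds; omega
    · exact ihr h h'

/-- A noncrossing family of intervals that contains the spans of `t` consists of them. -/
theorem isSpan_of_noncrossing {t : BinaryTree Unit} {o : ℕ} {E : ℕ → ℕ → Prop}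
    (hE : ∀ a b c d, E a b → E c d → a < c → c ≤ b → d ≤ b)
    (ht : ∀ a b, IsSpan t o a b → E a b) {a b : ℕ} (hab : E a b) (ha : o ≤ a) (hle : a ≤ b)
    (hb : b ≤ o + t.numNodes) : IsSpan t o a b := by
  induction t generalizing o with
  | nil => simp only [IsSpan, BinaryTree.numNodes] at *; omega
  | node _ l r ihl ihr =>
    simp only [BinaryTree.numNodes] at hb
    rcases Nat.lt_or_ge (o + l.numNodes) b with h | h
    · rcases Nat.lt_or_ge (o + l.numNodes) a with h' | h'
      · exact Or.inr (Or.inr (ihr (fun a b h => ht a b (Or.inr (Or.inr h))) (by omega) (by omega)))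
      -- An interval that meets both subtrees must contain both of their root spans, so it is the
      -- span of the whole tree.
      · have h1 := ht _ _ (Or.inr (Or.inl (isSpan_root l o)))
        have h2 := ht _ _ (Or.inr (Or.inr (isSpan_root r (o + l.numNodes + 1))))
        have e1 : a = o := by
          by_contra hne
          have := hE _ _ _ _ h1 hab (by omega) h'
          omega
        have e2 := hE _ _ _ _ hab h2 (by omega) (by omega)
        exact Or.inl ⟨e1, by omega⟩
    · exact Or.inr (Or.inl (ihl (fun a b h => ht a b (Or.inr (Or.inl h))) ha h))

/-- The root spans of `l` and `r` are spans of `t'`. If the sizes of `l` and `l'` differed, one of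
them would straddle the split of `t'` without being its whole span. Hence a single inclusion of
spans is enough. -/
theorem eq_of_isSpan {t t' : BinaryTree Unit} {o : ℕ} (hn : t.numNodes = t'.numNodes)
    (h : ∀ a b, IsSpan t o a b → IsSpan t' o a b) : t = t' := by
  induction t generalizing t' o with
  | nil =>
    cases t' with
    | nil => rfl
    | node => simp [BinaryTree.numNodes] at hn
  | node _ l r ihl ihr =>
    cases t' with
    | nil => simp [BinaryTree.numNodes] at hn
    | node _ l' r' =>
      simp only [BinaryTree.numNodes] at hn
      have h1 := h _ _ (Or.inr (Or.inl (isSpan_root l o)))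
      have h2 := h _ _ (Or.inr (Or.inr (isSpan_root r (o + l.numNodes + 1))))
      have e : l.numNodes = l'.numNodes := by
        apply le_antisymm
        · by_contra hlt
          rw [isSpan_node_across (by omega) (by omega)] at h1
          omega
        · by_contra hlt
          rw [isSpan_node_across (by omega) (by omega)] at h2
          omega
      have hl : l = l' := ihl e (o := o) fun a b hab => by
        have := h a b (Or.inr (Or.inl hab))
        rwa [isSpan_node_left (by have := hab.bounds; omega)] at this
      have hr : r = r' := ihr (by omega) (o := o + l.numNodes + 1) fun a b hab => by
        have := h a b (Or.inr (Or.inr hab))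
        rwa [isSpan_node_right (by have := hab.bounds; omega), ← e] at this
      rw [hl, hr]

theorem exists_tree_of_splits {E : ℕ → ℕ → Prop}
    (hE : ∀ a b, E a b → a < b → ∃ r, a ≤ r ∧ r < b ∧ E a r ∧ E (r + 1) b) {a b : ℕ}
    (hab : E a b) (hle : a ≤ b) :
    ∃ t : BinaryTree Unit, t.numNodes = b - a ∧ ∀ c d, IsSpan t a c d → E c d := by
  induction hm : b - a using Nat.strong_induction_on generalizing a b with
  | _ m ih =>
    rcases hle.eq_or_lt with rfl | hlt
    · refine ⟨.nil, by simp [BinaryTree.numNodes]; omega, fun c d h => ?_⟩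
      obtain ⟨rfl, rfl⟩ := h
      exact hab
    · obtain ⟨r, h1, h2, h3, h4⟩ := hE a b hab hlt
      obtain ⟨t, ht, ht'⟩ := ih _ (by omega) h3 h1 rfl
      obtain ⟨u, hu, hu'⟩ := ih _ (by omega) h4 h2 rfl
      refine ⟨.node () t u, by simp only [BinaryTree.numNodes]; omega, fun c d h => ?_⟩
      rcases h with ⟨rfl, h⟩ | h | h
      · have : d = b := by omega
        rwa [this]
      · exact ht' c d h
      · refine hu' c d ?_
        convert h using 1
        omega

end Spans

end Stokes

namespace Stokes

/-! ### The quadrangulation of a binary tree -/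

section QuadOf

variable {n : ℕ}

/-- The quadrangulation of the `(2 n + 2)`-gon whose inner edges are the `(2 p, 2 q + 1)`, where
the leaves `p, …, q` are those below some inner node, other than the root, of the tree `t`. -/
def quadOf (n : ℕ) (t : BinaryTree Unit) : EdgeSet n :=
  {e | ∃ a b : Fin (2 * n + 2), a.val + 1 < b.val ∧ ¬ (a.val = 0 ∧ b.val = 2 * n + 1) ∧
    (a.val % 2 = 0 ∧ b.val % 2 = 1 ∧ IsSpan t 0 (a.val / 2) (b.val / 2)) ∧ e = s(a, b)}

theorem mem_quadOf_iff {t : BinaryTree Unit} {a b : Fin (2 * n + 2)} (h : a < b) :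
    s(a, b) ∈ quadOf n t ↔ a.val + 1 < b.val ∧ ¬ (a.val = 0 ∧ b.val = 2 * n + 1) ∧
      (a.val % 2 = 0 ∧ b.val % 2 = 1 ∧ IsSpan t 0 (a.val / 2) (b.val / 2)) := by
  constructor
  · rintro ⟨c, d, h1, h2, h3, e⟩
    rcases Sym2.eq_iff.1 e with ⟨rfl, rfl⟩ | ⟨rfl, rfl⟩
    · exact ⟨h1, h2, h3⟩
    · rw [Fin.lt_def] at h
      omega
  · rintro ⟨h1, h2, h3⟩
    exact ⟨a, b, h1, h2, h3, rfl⟩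

/-- Boundary edges remove the exceptions of `mem_quadOf_iff`: the root span is the edge `(0, 2 n +
1)`, and the leaves are the edges `(2 p, 2 p + 1)`. -/
theorem isEdge_quadOf_iff {t : BinaryTree Unit} (ht : t.numNodes = n) {a b : Fin (2 * n + 2)}
    (h : a < b) : IsEdge (quadOf n t) a b ↔ a.val + 1 = b.val ∨
      (a.val % 2 = 0 ∧ b.val % 2 = 1 ∧ IsSpan t 0 (a.val / 2) (b.val / 2)) := by
  unfold IsEdge
  rw [mem_quadOf_iff h, isBoundary_iff_of_lt h]
  rw [Fin.lt_def] at h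
  have h1 : a.val = 0 ∧ b.val = 2 * n + 1 → IsSpan t 0 (a.val / 2) (b.val / 2) := by
    rintro ⟨h1, h2⟩
    convert isSpan_root t 0 using 1 <;> omega
  have h2 : a.val = 0 ∧ b.val = 2 * n + 1 → a.val % 2 = 0 ∧ b.val % 2 = 1 := by omega
  grind

theorem noncrossing_quadOf {t : BinaryTree Unit} (ht : t.numNodes = n) :
    Noncrossing (quadOf n t) := by
  intro a b c d hab hcd h1 h2 h3
  rw [isEdge_quadOf_iff ht (h1.trans h2)] at hab
  rw [isEdge_quadOf_iff ht (h2.trans h3)] at hcd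
  rw [Fin.lt_def] at *
  rcases hab with hab | ⟨ha, hb, hab⟩
  · omega
  · rcases hcd with hcd | ⟨hc, hd, hcd⟩
    · omega
    · have := hab.noncrossing hcd (by omega) (by omega)
      omega

theorem isRegion_quadOf {t : BinaryTree Unit} (ht : t.numNodes = n) {p r q : ℕ}
    (hpr : p ≤ r) (hrq : r < q) (hq : IsSpan t 0 p q) (h1 : IsSpan t 0 p r)
    (h2 : IsSpan t 0 (r + 1) q) {i k l j : Fin (2 * n + 2)} (hi : i.val = 2 * p)
    (hk : k.val = 2 * r + 1) (hl : l.val = 2 * r + 2) (hj : j.val = 2 * q + 1) :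
    IsRegion (quadOf n t) {i, k, l, j} := by
  have hik : i < k := by rw [Fin.lt_def]; omega
  have hkl : k < l := by rw [Fin.lt_def]; omega
  have hlj : l < j := by rw [Fin.lt_def]; omega
  have e1 : i.val / 2 = p := by omega
  have e2 : k.val / 2 = r := by omega
  have e3 : l.val / 2 = r + 1 := by omega
  have e4 : j.val / 2 = q := by omega
  rw [isRegion_square_iff hik hkl hlj]
  simp only [isEdge_quadOf_iff ht, hik, hkl, hlj, hik.trans hkl, hik.trans (hkl.trans hlj),
    hkl.trans hlj, e1, e2, e3, e4, hq, h1, h2, and_true]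
  refine ⟨⟨?_, ?_, ?_, ?_⟩, fun h => ?_, fun h => ?_⟩ <;> omega

theorem isQuadrangulation_quadOf {t : BinaryTree Unit} (ht : t.numNodes = n) :
    IsQuadrangulation (quadOf n t) where
  inner := by
    have key : ∀ a b : Fin (2 * n + 2), a < b → s(a, b) ∈ quadOf n t → ¬ IsBoundary a b := by
      intro a b hlt hab
      rw [isBoundary_iff_of_lt hlt]
      rw [mem_quadOf_iff hlt] at hab
      omega
    intro a b hab
    have hne : a ≠ b := by
      rintro rfl
      obtain ⟨c, d, h1, -, -, e⟩ := hab
      rcases Sym2.eq_iff.1 e with ⟨rfl, rfl⟩ | ⟨rfl, rfl⟩ <;> omega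
    refine ⟨hne, ?_⟩
    rcases lt_or_gt_of_ne hne with hlt | hlt
    · exact key a b hlt hab
    · rw [isBoundary_comm]
      exact key b a hlt (by rwa [Sym2.eq_swap])
  noncrossing := by
    have nc := noncrossing_quadOf ht
    intro a b c d hab hcd hx
    have h1 : IsEdge (quadOf n t) a b := Or.inl hab
    have h2 : IsEdge (quadOf n t) c d := Or.inl hcd
    have h3 := h1.symm
    have h4 := h2.symm
    -- `Noncrossing` uses the linear order and `Crosses` the cyclic one, so every arrangement of the
    -- four ends is needed.
    have := nc a b c d h1 h2
    have := nc a b d c h1 h4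
    have := nc b a c d h3 h2
    have := nc b a d c h3 h4
    have := nc c d a b h2 h1
    have := nc c d b a h2 h3
    have := nc d c a b h4 h1
    have := nc d c b a h4 h3
    unfold Crosses Cw at hx
    grind
  quadrilateral := by
    intro S hS
    have h3 := hS.1
    have hne : S.Nonempty := Finset.card_pos.1 (by omega)
    set i := S.min' hne with hi
    set j := S.max' hne with hj
    have hiS : i ∈ S := S.min'_mem hne
    have hjS : j ∈ S := S.max'_mem hne
    have hb : ∀ c ∈ S, i ≤ c ∧ c ≤ j := fun c hc => ⟨S.min'_le c hc, S.le_max' c hc⟩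
    have hlt : i.val + 1 < j.val := by
      have : S.card ≤ (Finset.Icc i j).card :=
        Finset.card_le_card fun c hc => Finset.mem_Icc.2 (hb c hc)
      rw [Fin.card_Icc] at this
      omega
    have hlt' : i < j := by rw [Fin.lt_def]; omega
    -- The first and last vertices of a region are cyclic neighbours, so they span an edge; its
    -- square must then be the whole region.
    have he := ((isRegion_iff.1 hS).2 i hiS j hjS hlt').2 (Or.inr hb)
    rw [isEdge_quadOf_iff ht hlt'] at he
    obtain ⟨h0, h1, he⟩ := he.resolve_left (by omega)
    obtain ⟨r, hr1, hr2, hs1, hs2⟩ := he.exists_split (by omega)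
    have hjlt := j.isLt
    let k : Fin (2 * n + 2) := ⟨2 * r + 1, by omega⟩
    let l : Fin (2 * n + 2) := ⟨2 * r + 2, by omega⟩
    have hsq := isRegion_quadOf ht hr1 hr2 he hs1 hs2 (i := i) (k := k) (l := l) (j := j)
      (by omega) rfl rfl (by omega)
    have hik : i < k := by simp only [Fin.lt_def, k]; omega
    have hkl : k < l := by simp only [Fin.lt_def, k, l]; omega
    have hlj : l < j := by simp only [Fin.lt_def, l]; omega
    rw [(noncrossing_quadOf ht).region_unique hS hsq hiS hjS (by simp) (by simp) hb
      (by simp; grind)]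
    rw [Finset.card_eq_succ]
    refine ⟨i, {k, l, j}, ?_, rfl, Finset.card_eq_three.2 ⟨k, l, j, hkl.ne, (hkl.trans hlj).ne,
      hlj.ne, rfl⟩⟩
    simp [hik.ne, (hik.trans hkl).ne, (hik.trans (hkl.trans hlj)).ne]

theorem edgesClockwise_quadOf {t : BinaryTree Unit} : EdgesClockwise (quadOf n t) := by
  intro a b hab hlt
  rw [mem_quadOf_iff hlt] at hab
  exact ⟨hab.2.2.1, hab.2.2.2.1⟩

/-- The squares provide the splits from which a tree is built; a priori `D` could have further
edges, but a noncrossing family containing all spans of a tree has no room for another interval. -/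
theorem exists_eq_quadOf {D : EdgeSet n} (hD : IsQuadrangulation D) (hc : EdgesClockwise D) :
    ∃ t : BinaryTree Unit, t.numNodes = n ∧ D = quadOf n t := by
  let E : ℕ → ℕ → Prop := fun p q => p ≤ q ∧ ∃ a b : Fin (2 * n + 2), a.val = 2 * p ∧
    b.val = 2 * q + 1 ∧ IsEdge D a b
  have hsplit : ∀ p q, E p q → p < q → ∃ r, p ≤ r ∧ r < q ∧ E p r ∧ E (r + 1) q := by
    rintro p q ⟨-, a, b, ha, hb, hab⟩ hpq
    obtain ⟨k, l, hak, hkl, hlb, hS⟩ := hD.exists_square hab (by omega)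
    obtain ⟨⟨h1, h2, h3, -⟩, -⟩ := (isRegion_square_iff hak hkl hlb).1 hS
    have o1 := hD.odd_sub h1 hak
    have o3 := hD.odd_sub h3 hlb
    rw [Fin.lt_def] at hak hkl hlb
    -- By parity `k` is odd, so the middle side is not clockwise and has to be a boundary edge.
    have hkl' : l.val = k.val + 1 := by
      by_contra hne
      have := hc.parity h2 (by omega)
      omega
    exact ⟨k.val / 2, by omega, by omega, ⟨by omega, a, k, ha, by omega, h1⟩,
      ⟨by omega, l, b, by omega, hb, h3⟩⟩
  have hroot : E 0 n := ⟨Nat.zero_le n, 0, Fin.last _, rfl, rfl, isEdge_zero_last rfl rfl⟩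
  obtain ⟨t, ht, htE⟩ := exists_tree_of_splits hsplit hroot (Nat.zero_le n)
  have hE : ∀ a b c d, E a b → E c d → a < c → c ≤ b → d ≤ b := by
    rintro p q p' q' ⟨-, a, b, ha, hb, hab⟩ ⟨-, c, d, hc, hd, hcd⟩ h1 h2
    by_contra h3
    refine hD.isNoncrossing a b c d hab hcd ?_ ?_ ?_ <;> rw [Fin.lt_def] <;> omega
  rw [Nat.sub_zero] at ht
  refine ⟨t, ht, ?_⟩
  have key : ∀ a b : Fin (2 * n + 2), a < b → (s(a, b) ∈ D ↔ s(a, b) ∈ quadOf n t) := by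
    intro a b hlt
    rw [mem_quadOf_iff hlt]
    have hb := b.isLt
    constructor
    · intro hab
      have hin := (hD.inner a b hab).2
      have hpar := hc a b hab hlt
      rw [isBoundary_iff_of_lt hlt] at hin
      rw [Fin.lt_def] at hlt
      refine ⟨by omega, by omega, hpar.1, hpar.2, ?_⟩
      exact isSpan_of_noncrossing hE htE ⟨by omega, a, b, by omega, by omega, Or.inl hab⟩
        (Nat.zero_le _) (by omega) (by omega)
    · rintro ⟨h1, h2, h3, h4, h5⟩
      obtain ⟨-, a', b', ha', hb', he⟩ := htE _ _ h5
      obtain rfl : a' = a := Fin.ext (by omega)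
      obtain rfl : b' = b := Fin.ext (by omega)
      refine he.resolve_right ?_
      rw [isBoundary_iff_of_lt hlt]
      omega
  ext e
  induction e using Sym2.ind with
  | _ a b =>
    rcases lt_trichotomy a b with h | rfl | h
    · exact key a b h
    · exact iff_of_false (fun h => (hD.inner _ _ h).1 rfl)
        fun h => ((isQuadrangulation_quadOf ht).inner _ _ h).1 rfl
    · rw [Sym2.eq_swap]
      exact key b a h

theorem quadOf_injective {t t' : BinaryTree Unit} (ht : t.numNodes = n) (ht' : t'.numNodes = n)
    (h : quadOf n t = quadOf n t') : t = t' := by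
  refine eq_of_isSpan (o := 0) (ht.trans ht'.symm) fun a b hab => ?_
  have hb := hab.bounds
  rcases hb.2.1.eq_or_lt with rfl | hlt
  · exact isSpan_leaf (by omega) (by omega)
  · have h1 : IsEdge (quadOf n t) ⟨2 * a, by omega⟩ ⟨2 * b + 1, by omega⟩ := by
      rw [isEdge_quadOf_iff ht (by simp only [Fin.lt_def]; omega)]
      refine Or.inr ⟨by simp, by simp only; omega, ?_⟩
      convert hab using 1 <;> simp only <;> omega
    rw [h, isEdge_quadOf_iff ht' (by simp only [Fin.lt_def]; omega)] at h1
    have h2 := (h1.resolve_left (by simp only; omega)).2.2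
    convert h2 using 1 <;> simp only <;> omega

end QuadOf

/-! ### Planar duality with ternary trees -/

section Duality

variable {n : ℕ}

/-- The ternary tree obtained by adding middle leaves. -/
def toTernary : BinaryTree Unit → TernaryTree
  | .nil => .leaf
  | .node _ l r => .node (toTernary l) .leaf (toTernary r)

theorem toBinary_toTernary (t : BinaryTree Unit) : (toTernary t).toBinary = t := by
  induction t with
  | nil => rfl
  | node _ l r ihl ihr => simp [toTernary, TernaryTree.toBinary, ihl, ihr]

theorem toTernary_toBinary {T : TernaryTree} (h : T.NoMiddle) : toTernary T.toBinary = T := by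
  induction T with
  | leaf => rfl
  | node l m r ihl ihm ihr =>
    obtain ⟨rfl, hl, hr⟩ := h
    simp [toTernary, TernaryTree.toBinary, ihl hl, ihr hr]

theorem noMiddle_toTernary (t : BinaryTree Unit) : (toTernary t).NoMiddle := by
  induction t with
  | nil => trivial
  | node _ l r ihl ihr => exact ⟨rfl, ihl, ihr⟩

theorem numNodes_toTernary (t : BinaryTree Unit) : (toTernary t).numNodes = t.numNodes := by
  induction t with
  | nil => rfl
  | node _ l r ihl ihr => simp [toTernary, TernaryTree.numNodes, BinaryTree.numNodes, ihl, ihr]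

theorem numNodes_toBinary {T : TernaryTree} (h : T.NoMiddle) :
    T.toBinary.numNodes = T.numNodes := by
  rw [← numNodes_toTernary, toTernary_toBinary h]

/-- Binary trees with `n` nodes correspond to ternary trees with `n` nodes and no middle branch. -/
def tamariEquivTernary (n : ℕ) : Tamari n ≃ {T : TernaryTree // T.numNodes = n ∧ T.NoMiddle} where
  toFun t := ⟨toTernary t.1, (numNodes_toTernary t.1).trans t.2, noMiddle_toTernary t.1⟩
  invFun T := ⟨T.1.toBinary, (numNodes_toBinary T.2.2).trans T.2.1⟩
  left_inv t := Subtype.ext (toBinary_toTernary t.1)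
  right_inv T := Subtype.ext (toTernary_toBinary T.2.2)

/-- Stated for a subtree `u` at leaf offset `o`, known only through its spans, so that the induction
can descend while the quadrangulation stays fixed. -/
theorem isDual_quadOf {t : BinaryTree Unit} (ht : t.numNodes = n) {u : BinaryTree Unit} {o : ℕ}
    (hu : ∀ a b, IsSpan u o a b → IsSpan t 0 a b) {i j : Fin (2 * n + 2)} (hi : i.val = 2 * o)
    (hj : j.val = 2 * (o + u.numNodes) + 1) : IsDual (quadOf n t) i j (toTernary u) := by
  induction u generalizing o i j with
  | nil => exact .leaf i j (by simp [BinaryTree.numNodes] at hj; omega)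
  | node _ l r ihl ihr =>
    simp only [BinaryTree.numNodes] at hj
    have hjlt := j.isLt
    have h0 := hu _ _ (Or.inl ⟨rfl, rfl⟩)
    have h1 := hu _ _ (Or.inr (Or.inl (isSpan_root l o)))
    have h2 := hu _ _ (Or.inr (Or.inr (isSpan_root r (o + l.numNodes + 1))))
    refine .node i ⟨2 * (o + l.numNodes) + 1, by omega⟩ ⟨2 * (o + l.numNodes) + 2, by omega⟩ j
      _ _ _ (by simp only [Fin.lt_def]; omega) (by simp only [Fin.lt_def]; omega)
      (by simp only [Fin.lt_def]; omega) ?_ ?_ (.leaf _ _ rfl) ?_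
    · refine isRegion_quadOf ht (p := o) (r := o + l.numNodes)
        (q := o + (l.numNodes + r.numNodes + 1)) (by omega) (by omega) h0 h1 ?_ hi rfl rfl hj
      convert h2 using 1
      omega
    · exact ihl (fun a b h => hu a b (Or.inr (Or.inl h))) hi rfl
    · exact ihr (fun a b h => hu a b (Or.inr (Or.inr h))) (by simp only; omega) (by omega)

theorem IsDual.unique {D : EdgeSet n} (hD : Noncrossing D) {i j : Fin (2 * n + 2)}
    {T T' : TernaryTree} (h : IsDual D i j T) (h' : IsDual D i j T') : T = T' := by
  induction h generalizing T' with
  | leaf i j h =>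
    cases h' with
    | leaf => rfl
    | node _ k l _ _ _ _ hik hkl hlj => rw [Fin.lt_def] at *; omega
  | node i k l j t₁ t₂ t₃ hik hkl hlj hs _ _ _ ih₁ ih₂ ih₃ =>
    cases h' with
    | leaf => rw [Fin.lt_def] at *; omega
    | node _ k' l' _ _ _ _ hik' hkl' hlj' hs' h₁ h₂ h₃ =>
      obtain ⟨rfl, rfl⟩ := square_unique hD hik hkl hlj hik' hkl' hlj' hs hs'
      rw [ih₁ h₁, ih₂ h₂, ih₃ h₃]

theorem isDualTree_quadOf_iff {t : BinaryTree Unit} (ht : t.numNodes = n) {T : TernaryTree} :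
    IsDualTree (quadOf n t) T ↔ toTernary t = T := by
  have h : IsDualTree (quadOf n t) (toTernary t) :=
    isDual_quadOf ht (o := 0) (fun _ _ h => h) rfl (by simp [ht])
  exact ⟨fun h' => IsDual.unique (noncrossing_quadOf ht) h h', fun e => e ▸ h⟩

/-- The comb whose inner nodes lie on its left branch. -/
def leftComb : ℕ → BinaryTree Unit
  | 0 => .nil
  | m + 1 => .node () (leftComb m) .nil

theorem numNodes_leftComb (m : ℕ) : (leftComb m).numNodes = m := by
  induction m with
  | zero => rfl
  | succ m ih => simp [leftComb, BinaryTree.numNodes, ih]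

theorem isSpan_leftComb_iff {m a b : ℕ} :
    IsSpan (leftComb m) 0 a b ↔ b ≤ m ∧ (a = 0 ∨ a = b) := by
  induction m with
  | zero => simp only [leftComb, IsSpan]; omega
  | succ m ih =>
    simp only [leftComb, IsSpan, ih, numNodes_leftComb, BinaryTree.numNodes]
    omega

/-- All inner edges of the fan start at `0`, and the non-leaf spans of the left comb are the
intervals `[0, q]`. -/
theorem catalanQuad_eq_quadOf (n : ℕ) : catalanQuad n = quadOf n (leftComb n) := by
  ext e
  constructor
  · rintro ⟨m, h1, h2, rfl⟩
    refine (mem_quadOf_iff (by simp [Fin.lt_def])).2 ?_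
    simp only [isSpan_leftComb_iff, Fin.val_zero, true_and, Nat.zero_div, true_or, and_true, Nat.zero_mod]
    refine ⟨by omega, by omega, by omega, by omega⟩
  · rintro ⟨a, b, h1, h2, ⟨h3, h4, h5⟩, rfl⟩
    have hb := b.isLt
    rw [isSpan_leftComb_iff] at h5
    refine ⟨b.val / 2, by omega, by omega, ?_⟩
    congr 2
    · exact Fin.ext (by rw [Fin.val_zero]; omega)
    · exact Fin.ext (by simp only; omega)

theorem isQuadrangulation_catalanQuad (n : ℕ) : IsQuadrangulation (catalanQuad n) := by
  rw [catalanQuad_eq_quadOf]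
  exact isQuadrangulation_quadOf (numNodes_leftComb n)

/-- Binary trees with `n` nodes correspond to `C_n`-compatible quadrangulations. -/
def compatibleOf (t : Tamari n) : CompatibleQuad (catalanQuad n) :=
  ⟨quadOf n t.1, isQuadrangulation_quadOf t.2,
    (isCompatible_catalanQuad_iff (isQuadrangulation_quadOf t.2)).2 edgesClockwise_quadOf⟩

theorem compatibleOf_bijective : Function.Bijective (compatibleOf (n := n)) := by
  refine ⟨fun t t' h => ?_, fun R => ?_⟩
  · exact Subtype.ext (quadOf_injective t.2 t'.2 (congrArg Subtype.val h))
  · obtain ⟨t, ht, e⟩ :=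
      exists_eq_quadOf R.2.1 ((isCompatible_catalanQuad_iff R.2.1).1 R.2.2)
    exact ⟨⟨t, ht⟩, Subtype.ext e.symm⟩

/-- The binary tree of a `C_n`-compatible quadrangulation. -/
noncomputable def binaryTreeEquiv (n : ℕ) : CompatibleQuad (catalanQuad n) ≃ Tamari n :=
  (Equiv.ofBijective _ compatibleOf_bijective).symm

theorem quadOf_binaryTreeEquiv (R : CompatibleQuad (catalanQuad n)) :
    quadOf n (binaryTreeEquiv n R).1 = R.1 :=
  congrArg Subtype.val ((Equiv.ofBijective _ compatibleOf_bijective).apply_symm_apply R)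

end Duality

end Stokes

namespace Stokes

/-! ### Rotations as exchanges of one span -/

section Rotations

/-- The family of intervals `E'` is obtained from `E` by replacing `[p, s]` by `[r + 1, q]`, as in a
rotation of the node `[p, q]`, whose subtrees are `[p, r]`, `[r + 1, s]` and `[s + 1, q]`. -/
structure RotatesAt (E E' : ℕ → ℕ → Prop) (p r s q : ℕ) : Prop where
  le : p ≤ r
  lt : r < s
  lt' : s < q
  outer : E p q
  old : E p s
  left : E p r
  middle : E (r + 1) s
  right : E (s + 1) q
  iff : ∀ a b, E' a b ↔ (E a b ∧ ¬ (a = p ∧ b = s)) ∨ (a = r + 1 ∧ b = q)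

theorem rotatesAt_root (a b c : BinaryTree Unit) {o r s q : ℕ} (hr : r = o + a.numNodes)
    (hs : s = r + 1 + b.numNodes) (hq : q = s + 1 + c.numNodes) :
    RotatesAt (IsSpan (.node () (.node () a b) c) o) (IsSpan (.node () a (.node () b c)) o)
      o r s q := by
  have e1 : o + (a.numNodes + b.numNodes + 1) + 1 = s + 1 := by omega
  have e2 : o + a.numNodes + 1 = r + 1 := by omega
  have e3 : r + 1 + b.numNodes + 1 = s + 1 := by omega
  have ha := isSpan_root a o
  have hb := isSpan_root b (r + 1)
  have hc := isSpan_root c (s + 1)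
  rw [← hr] at ha
  rw [← hs] at hb
  rw [← hq] at hc
  refine ⟨by omega, by omega, by omega, ?_, ?_, ?_, ?_, ?_, fun x y => ?_⟩ <;>
    simp only [IsSpan, BinaryTree.numNodes, e1, e2, e3, true_and]
  · exact Or.inl (by omega)
  · exact Or.inr (Or.inl (Or.inl (by omega)))
  · exact Or.inr (Or.inl (Or.inr (Or.inl ha)))
  · exact Or.inr (Or.inl (Or.inr (Or.inr hb)))
  · exact Or.inr (Or.inr hc)
  · have h1 : IsSpan a o x y → y ≤ r := fun h => by have := h.bounds; omega
    have h2 : IsSpan b (r + 1) x y → o < x := fun h => by have := h.bounds; omega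
    have h3 : IsSpan c (s + 1) x y → o < x := fun h => by have := h.bounds; omega
    have h4 : (x = o ∧ y = o + (a.numNodes + (b.numNodes + c.numNodes + 1) + 1)) ↔
      (x = o ∧ y = q) := by omega
    have h5 : (x = o ∧ y = o + (a.numNodes + b.numNodes + 1 + c.numNodes + 1)) ↔
      (x = o ∧ y = q) := by omega
    have h6 : (x = r + 1 ∧ y = r + 1 + (b.numNodes + c.numNodes + 1)) ↔
      (x = r + 1 ∧ y = q) := by omega
    have h7 : (x = o ∧ y = o + (a.numNodes + b.numNodes + 1)) ↔ (x = o ∧ y = s) := by omega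
    rw [h4, h5, h6, h7]
    grind

theorem RotatesAt.node_left {a a' b : BinaryTree Unit} {o p r s q : ℕ}
    (hn : a.numNodes = a'.numNodes) (h : RotatesAt (IsSpan a o) (IsSpan a' o) p r s q) :
    RotatesAt (IsSpan (.node () a b) o) (IsSpan (.node () a' b) o) p r s q := by
  have hb := h.outer.bounds
  have h1 := h.lt'
  refine ⟨h.le, h.lt, h.lt', Or.inr (Or.inl h.outer), Or.inr (Or.inl h.old),
    Or.inr (Or.inl h.left), Or.inr (Or.inl h.middle), Or.inr (Or.inl h.right), fun x y => ?_⟩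
  simp only [IsSpan, h.iff, ← hn]
  have h2 : IsSpan b (o + a.numNodes + 1) x y → q < x := fun h => by have := h.bounds; omega
  have h3 := h.lt
  have h4 := h.le
  grind

theorem RotatesAt.node_right {a b b' : BinaryTree Unit} {o p r s q : ℕ}
    (hn : b.numNodes = b'.numNodes)
    (h : RotatesAt (IsSpan b (o + a.numNodes + 1)) (IsSpan b' (o + a.numNodes + 1)) p r s q) :
    RotatesAt (IsSpan (.node () a b) o) (IsSpan (.node () a b') o) p r s q := by
  have hb := h.outer.bounds
  have h1 := h.lt'
  refine ⟨h.le, h.lt, h.lt', Or.inr (Or.inr h.outer), Or.inr (Or.inr h.old),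
    Or.inr (Or.inr h.left), Or.inr (Or.inr h.middle), Or.inr (Or.inr h.right), fun x y => ?_⟩
  simp only [IsSpan, h.iff, ← hn]
  have h2 : IsSpan a o x y → y < p := fun h => by have := h.bounds; omega
  have h3 := h.lt
  have h4 := h.le
  grind

theorem Rotation.exists_rotatesAt {t t' : BinaryTree Unit} (h : Rotation t t') (o : ℕ) :
    ∃ p r s q, RotatesAt (IsSpan t o) (IsSpan t' o) p r s q := by
  induction h generalizing o with
  | root a b c => exact ⟨_, _, _, _, rotatesAt_root a b c rfl rfl rfl⟩
  | left a a' b h ih =>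
    obtain ⟨p, r, s, q, h'⟩ := ih o
    exact ⟨p, r, s, q, h'.node_left h.numNodes_eq⟩
  | right a b b' h ih =>
    obtain ⟨p, r, s, q, h'⟩ := ih (o + a.numNodes + 1)
    exact ⟨p, r, s, q, h'.node_right h.numNodes_eq⟩

/-- The split of a node into the spans of its two subtrees is unique. -/
theorem eq_of_isSpan_split {l r : BinaryTree Unit} {o s q : ℕ}
    (h1 : IsSpan (.node () l r) o o s) (h2 : IsSpan (.node () l r) o (s + 1) q)
    (hq : q = o + (l.numNodes + r.numNodes + 1)) : s = o + l.numNodes := by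
  have hb2 := h2.bounds
  have e1 : s ≤ o + l.numNodes := by
    by_contra hlt
    rw [isSpan_node_across (by omega) (by omega)] at h1
    omega
  by_contra hlt
  have hb1 := h1.bounds
  rw [isSpan_node_across (by omega) (by omega)] at h2
  omega

/-- Descend to the subtree whose span is `[p, q]`. Splits being unique, its left child is `[p, s]`,
with children `[p, r]` and `[r + 1, s]`, and this is the pattern that can be rotated. -/
theorem exists_rotation {t : BinaryTree Unit} {o p r s q : ℕ} (hpr : p ≤ r) (hrs : r < s)
    (hsq : s < q) (h1 : IsSpan t o p q) (h2 : IsSpan t o p s) (h3 : IsSpan t o p r)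
    (h4 : IsSpan t o (r + 1) s) (h5 : IsSpan t o (s + 1) q) :
    ∃ t', Rotation t t' ∧ RotatesAt (IsSpan t o) (IsSpan t' o) p r s q := by
  induction t generalizing o with
  | nil => simp only [IsSpan] at h1; omega
  | node _ l c ihl ihc =>
    rcases h1 with ⟨rfl, hq⟩ | h1 | h1
    · have e := eq_of_isSpan_split h2 h5 hq
      rw [isSpan_node_left e.le] at h2 h4
      rw [isSpan_node_left (by omega)] at h3
      cases l with
      | nil => simp only [IsSpan] at h2; omega
      | node _ a b =>
        simp only [BinaryTree.numNodes] at e hq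
        have e' := eq_of_isSpan_split h3 h4 e
        exact ⟨_, .root a b c, rotatesAt_root a b c e' (by omega) (by omega)⟩
    · have hb := h1.bounds
      rw [isSpan_node_left (by omega)] at h2 h3 h4 h5
      obtain ⟨t', h, h'⟩ := ihl h1 h2 h3 h4 h5
      exact ⟨_, .left _ _ _ h, h'.node_left h.numNodes_eq⟩
    · have hb := h1.bounds
      rw [isSpan_node_right (by omega)] at h2 h3 h4 h5
      obtain ⟨t', h, h'⟩ := ihc h1 h2 h3 h4 h5
      exact ⟨_, .right _ _ _ h, h'.node_right h.numNodes_eq⟩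

theorem exists_rotation_to {t : BinaryTree Unit} {o p r s q : ℕ} (hpr : p ≤ r) (hrs : r < s)
    (hsq : s < q) (h1 : IsSpan t o p q) (h2 : IsSpan t o p r) (h3 : IsSpan t o (r + 1) q)
    (h4 : IsSpan t o (r + 1) s) (h5 : IsSpan t o (s + 1) q) :
    ∃ t', Rotation t' t ∧ RotatesAt (IsSpan t' o) (IsSpan t o) p r s q := by
  induction t generalizing o with
  | nil => simp only [IsSpan] at h1; omega
  | node _ a d iha ihd =>
    rcases h1 with ⟨rfl, hq⟩ | h1 | h1
    · have e := eq_of_isSpan_split h2 h3 hq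
      rw [isSpan_node_right (by omega), ← e] at h3 h4 h5
      cases d with
      | nil => simp only [IsSpan] at h3; omega
      | node _ b c =>
        simp only [BinaryTree.numNodes] at hq
        have e' := eq_of_isSpan_split h4 h5 (by omega)
        exact ⟨_, .root a b c, rotatesAt_root a b c e e' (by omega)⟩
    · have hb := h1.bounds
      rw [isSpan_node_left (by omega)] at h2 h3 h4 h5
      obtain ⟨t', h, h'⟩ := iha h1 h2 h3 h4 h5
      exact ⟨_, .left _ _ _ h, h'.node_left h.numNodes_eq⟩
    · have hb := h1.bounds
      rw [isSpan_node_right (by omega)] at h2 h3 h4 h5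
      obtain ⟨t', h, h'⟩ := ihd h1 h2 h3 h4 h5
      exact ⟨_, .right _ _ _ h, h'.node_right h.numNodes_eq⟩

/-- The rotation available at `p, r, s, q` yields exactly the spans of `t'`, and spans determine the
tree. -/
theorem rotation_of_rotatesAt {t t' : BinaryTree Unit} {o p r s q : ℕ}
    (hn : t.numNodes = t'.numNodes) (h : RotatesAt (IsSpan t o) (IsSpan t' o) p r s q) :
    Rotation t t' := by
  obtain ⟨u, hu, h'⟩ :=
    exists_rotation h.le h.lt h.lt' h.outer h.old h.left h.middle h.right
  have e : u = t' := eq_of_isSpan (o := o) (hu.numNodes_eq.symm.trans hn)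
    fun a b hab => (h.iff a b).2 ((h'.iff a b).1 hab)
  exact e ▸ hu

/-- An inner node other than the root is the left or the right child of another node. -/
theorem IsSpan.exists_parent {t : BinaryTree Unit} {o p q : ℕ} (h : IsSpan t o p q)
    (hne : ¬ (p = o ∧ q = o + t.numNodes)) :
    (∃ q', q < q' ∧ IsSpan t o p q' ∧ IsSpan t o (q + 1) q') ∨
      ∃ p', p' < p ∧ IsSpan t o p' q ∧ IsSpan t o p' (p - 1) := by
  induction t generalizing o with
  | nil => simp only [IsSpan, BinaryTree.numNodes] at h hne; omega
  | node _ l r ihl ihr =>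
    have hl : ∀ a b, IsSpan l o a b → IsSpan (.node () l r) o a b := fun a b h => Or.inr (Or.inl h)
    have hr : ∀ a b, IsSpan r (o + l.numNodes + 1) a b → IsSpan (.node () l r) o a b :=
      fun a b h => Or.inr (Or.inr h)
    have hroot := isSpan_root (.node () l r) o
    have hrl := hl _ _ (isSpan_root l o)
    have hrr := hr _ _ (isSpan_root r _)
    simp only [BinaryTree.numNodes] at hne hroot
    rcases h with h | h | h
    · omega
    · by_cases h' : p = o ∧ q = o + l.numNodes
      · obtain ⟨rfl, rfl⟩ := h'
        refine Or.inl ⟨_, by omega, hroot, ?_⟩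
        convert hrr using 1
        omega
      · rcases ihl h h' with ⟨q', h1, h2, h3⟩ | ⟨p', h1, h2, h3⟩
        · exact Or.inl ⟨q', h1, hl _ _ h2, hl _ _ h3⟩
        · exact Or.inr ⟨p', h1, hl _ _ h2, hl _ _ h3⟩
    · by_cases h' : p = o + l.numNodes + 1 ∧ q = o + l.numNodes + 1 + r.numNodes
      · obtain ⟨rfl, rfl⟩ := h'
        refine Or.inr ⟨o, by omega, ?_, hrl⟩
        convert hroot using 1
        omega
      · rcases ihr h h' with ⟨q', h1, h2, h3⟩ | ⟨p', h1, h2, h3⟩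
        · exact Or.inl ⟨q', h1, hr _ _ h2, hr _ _ h3⟩
        · exact Or.inr ⟨p', h1, hr _ _ h2, hr _ _ h3⟩

/-- If the spans of two trees differ by the exchange of two intervals, then the trees differ by a
rotation. -/
theorem rotation_or_rotation_of_exchange {t t' : BinaryTree Unit} {o x y x' y' : ℕ}
    (hn : t.numNodes = t'.numNodes) (hxy : x < y) (hne : ¬ (x = o ∧ y = o + t.numNodes))
    (hx : IsSpan t o x y) (hx' : ¬ IsSpan t o x' y')
    (h : ∀ a b, IsSpan t' o a b ↔ (IsSpan t o a b ∧ ¬ (a = x ∧ b = y)) ∨ (a = x' ∧ b = y')) :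
    Rotation t t' ∨ Rotation t' t := by
  obtain ⟨r, hr1, hr2, hl, hm⟩ := hx.exists_split hxy
  have mem : ∀ a b, IsSpan t o a b → ¬ (a = x ∧ b = y) → IsSpan t' o a b :=
    fun a b h1 h2 => (h a b).2 (Or.inl ⟨h1, h2⟩)
  have hold : ¬ IsSpan t' o x y := by
    intro h'
    rcases (h x y).1 h' with h' | h'
    · exact h'.2 ⟨rfl, rfl⟩
    · exact hx' (h'.1 ▸ h'.2 ▸ hx)
  have hl' := mem _ _ hl (by omega)
  have hm' := mem _ _ hm (by omega)
  have new : ∀ a b, IsSpan t' o a b → ¬ IsSpan t o a b → x' = a ∧ y' = b := by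
    intro a b h1 h2
    rcases (h a b).1 h1 with h1 | h1
    · exact absurd h1.1 h2
    · exact ⟨h1.1.symm, h1.2.symm⟩
  rcases hx.exists_parent hne with ⟨q, hq, h1, h2⟩ | ⟨p, hp, h1, h2⟩
  · have h1' := mem _ _ h1 (by omega)
    have h2' := mem _ _ h2 (by omega)
    -- Here `[x, y]` is a left child. Its parent `[x, q]`, its sibling and its two children survive
    -- in `t'`, so the parent splits there at `r` or at `y`; the latter would restore `[x, y]`.
    obtain ⟨z, hz1, hz2, hz3, hz4⟩ := h1'.exists_split (by omega)
    have hz : z = r := by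
      rcases lt_trichotomy z r with hlt | heq | hlt
      · have := hl'.noncrossing hz4 (by omega) (by omega)
        omega
      · exact heq
      · have hzy : y ≤ z := by
          by_contra hlt'
          have := hm'.noncrossing hz4 (by omega) (by omega)
          omega
        rcases hzy.eq_or_lt with heq | hlt'
        · exact absurd (heq ▸ hz3) hold
        · have := hz3.noncrossing h2' (by omega) (by omega)
          omega
    subst hz
    obtain ⟨rfl, rfl⟩ := new _ _ hz4 fun h' => by
      have := hx.noncrossing h' (by omega) (by omega)
      omega
    exact Or.inl (rotation_of_rotatesAt hn ⟨hr1, hr2, hq, h1, hx, hl, hm, h2, h⟩)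
  · have h1' := mem _ _ h1 (by omega)
    have h2' := mem _ _ h2 (by omega)
    -- Here `[x, y]` is a right child with parent `[p, y]`. In `t'` this parent splits at `r`, or at
    -- `x - 1`, which would restore `[x, y]`.
    obtain ⟨z, hz1, hz2, hz3, hz4⟩ := h1'.exists_split (by omega)
    have hz : z = r := by
      rcases lt_trichotomy z r with hlt | heq | hlt
      · have hzx : z < x := by
          by_contra hlt'
          have := hz3.noncrossing hl' (by omega) (by omega)
          omega
        rcases (Nat.le_sub_one_of_lt hzx).eq_or_lt with heq | hlt'
        · have : z + 1 = x := by omega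
          exact absurd (this ▸ hz4) hold
        · have := h2'.noncrossing hz4 (by omega) (by omega)
          omega
      · exact heq
      · have := hz3.noncrossing hm' (by omega) (by omega)
        omega
    subst hz
    obtain ⟨rfl, rfl⟩ := new _ _ hz3 fun h' => by
      have := h'.noncrossing hx (by omega) (by omega)
      omega
    have ex : x - 1 + 1 = x := by omega
    -- The roles are reversed: `[x', y']` in `t'` is the old span, and `[x, y]` is the one created
    -- by the rotation to `t`.
    refine Or.inr (rotation_of_rotatesAt (o := o) (p := x') (r := x - 1) (s := y') (q := y) hn.symm
      ⟨by omega, by omega, hz2, h1', hz3, h2', ex.symm ▸ hl', hm', fun a b => ?_⟩)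
    rw [h, ex]
    have e1 : (a = x ∧ b = y) → IsSpan t o a b := by rintro ⟨rfl, rfl⟩; exact hx
    have e2 : (a = x' ∧ b = y') → ¬ IsSpan t o a b := by rintro ⟨rfl, rfl⟩; exact hx'
    have e3 : (a = x' ∧ b = y') → ¬ (a = x ∧ b = y) := by omega
    generalize IsSpan t o a b = A at *
    grind

end Rotations

end Stokes

namespace Stokes

/-! ### Flips are rotations -/

section Flips

variable {n : ℕ}

theorem sym2_eq_iff_of_lt {α : Type*} [LinearOrder α] {a b c d : α} (hab : a < b) (hcd : c < d) :
    s(a, b) = s(c, d) ↔ a = c ∧ b = d := by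
  rw [Sym2.eq_iff]
  refine or_iff_left ?_
  rintro ⟨rfl, rfl⟩
  exact hab.not_gt hcd

theorem isSpan_of_isEdge {t : BinaryTree Unit} (ht : t.numNodes = n) {a b : Fin (2 * n + 2)}
    (hlt : a < b) (ha : a.val % 2 = 0) (hb : b.val % 2 = 1) (h : IsEdge (quadOf n t) a b) :
    IsSpan t 0 (a.val / 2) (b.val / 2) := by
  have hblt := b.isLt
  rcases (isEdge_quadOf_iff ht hlt).1 h with h | h
  · have e : b.val / 2 = a.val / 2 := by omega
    rw [e]
    exact isSpan_leaf (Nat.zero_le _) (by omega)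
  · exact h.2.2

theorem isEdge_of_isSpan {t : BinaryTree Unit} (ht : t.numNodes = n) {a b : Fin (2 * n + 2)}
    {p q : ℕ} (hpq : p ≤ q) (ha : a.val = 2 * p) (hb : b.val = 2 * q + 1) (h : IsSpan t 0 p q) :
    IsEdge (quadOf n t) a b := by
  rw [isEdge_quadOf_iff ht (by rw [Fin.lt_def]; omega)]
  refine Or.inr ⟨by omega, by omega, ?_⟩
  convert h using 1 <;> omega

theorem mem_quadOf_of_isSpan {t : BinaryTree Unit} {a b : Fin (2 * n + 2)}
    {p q : ℕ} (hpq : p < q) (hne : ¬ (p = 0 ∧ q = n)) (ha : a.val = 2 * p) (hb : b.val = 2 * q + 1)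
    (h : IsSpan t 0 p q) : s(a, b) ∈ quadOf n t := by
  rw [mem_quadOf_iff (by rw [Fin.lt_def]; omega)]
  refine ⟨by omega, by omega, by omega, by omega, ?_⟩
  convert h using 1 <;> omega

theorem eq_succ_of_isEdge {t : BinaryTree Unit} (ht : t.numNodes = n) {a b : Fin (2 * n + 2)}
    (hlt : a < b) (ha : a.val % 2 = 1) (h : IsEdge (quadOf n t) a b) : b.val = a.val + 1 := by
  rcases (isEdge_quadOf_iff ht hlt).1 h with h | h <;> omega

/-- Inner edges only see spans that are neither leaves nor the root. Those two kinds occur in both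
trees and are not exchanged, by `hxy`, `hxy'`, `hne` and `hne'`, so the edge sets and the full span
families carry the same information. -/
theorem quadOf_eq_exchange_iff {t t' : BinaryTree Unit} (ht : t.numNodes = n)
    (ht' : t'.numNodes = n) {a b c d : Fin (2 * n + 2)} {x y x' y' : ℕ}
    (hc : c.val = 2 * x) (hd : d.val = 2 * y + 1) (ha : a.val = 2 * x') (hb : b.val = 2 * y' + 1)
    (hxy : x < y) (hxy' : x' < y') (hne : ¬ (x = 0 ∧ y = n)) (hne' : ¬ (x' = 0 ∧ y' = n)) :
    quadOf n t' = insert s(a, b) (quadOf n t \ {s(c, d)}) ↔ ∀ u v, IsSpan t' 0 u v ↔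
      (IsSpan t 0 u v ∧ ¬ (u = x ∧ v = y)) ∨ (u = x' ∧ v = y') := by
  have hblt := b.isLt
  have hab : a < b := by rw [Fin.lt_def]; omega
  have hcd : c < d := by rw [Fin.lt_def]; omega
  have diag : ∀ (t : BinaryTree Unit) (e : Fin (2 * n + 2)), s(e, e) ∉ quadOf n t := by
    rintro t e ⟨u, v, h, -, -, h'⟩
    rcases Sym2.eq_iff.1 h' with ⟨rfl, rfl⟩ | ⟨rfl, rfl⟩ <;> omega
  have key : quadOf n t' = insert s(a, b) (quadOf n t \ {s(c, d)}) ↔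
      ∀ u v : Fin (2 * n + 2), u < v → (s(u, v) ∈ quadOf n t' ↔
        (s(u, v) ∈ quadOf n t ∧ ¬ (u = c ∧ v = d)) ∨ (u = a ∧ v = b)) := by
    constructor
    · intro h u v huv
      rw [h, Set.mem_insert_iff, Set.mem_sdiff, Set.mem_singleton_iff, sym2_eq_iff_of_lt huv hab,
        sym2_eq_iff_of_lt huv hcd, or_comm]
    · intro h
      have key : ∀ u v : Fin (2 * n + 2), u < v → (s(u, v) ∈ quadOf n t' ↔
          s(u, v) ∈ insert s(a, b) (quadOf n t \ {s(c, d)})) := by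
        intro u v huv
        rw [h u v huv, Set.mem_insert_iff, Set.mem_sdiff, Set.mem_singleton_iff,
          sym2_eq_iff_of_lt huv hab, sym2_eq_iff_of_lt huv hcd, or_comm]
      ext e
      induction e using Sym2.ind with
      | _ u v =>
        rcases lt_trichotomy u v with huv | rfl | huv
        · exact key u v huv
        · refine iff_of_false (diag _ _) ?_
          rintro (h' | ⟨h', -⟩)
          · rcases Sym2.eq_iff.1 h' with ⟨rfl, rfl⟩ | ⟨rfl, rfl⟩ <;> exact hab.ne rfl
          · exact diag _ _ h'
        · rw [Sym2.eq_swap]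
          exact key v u huv
  rw [key]
  constructor
  · intro h u v
    by_cases hv : u ≤ v ∧ v ≤ n
    · rcases hv.1.eq_or_lt with rfl | huv
      · exact iff_of_true (isSpan_leaf (Nat.zero_le _) (by omega))
          (Or.inl ⟨isSpan_leaf (Nat.zero_le _) (by omega), by omega⟩)
      · by_cases hr : u = 0 ∧ v = n
        · obtain ⟨rfl, rfl⟩ := hr
          have h1 := isSpan_root t 0
          have h2 := isSpan_root t' 0
          rw [ht, Nat.zero_add] at h1
          rw [ht', Nat.zero_add] at h2
          exact iff_of_true h2 (Or.inl ⟨h1, by omega⟩)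
        · have := h ⟨2 * u, by omega⟩ ⟨2 * v + 1, by omega⟩ (by simp only [Fin.lt_def]; omega)
          have e1 : 2 * u / 2 = u := by omega
          have e2 : (2 * v + 1) / 2 = v := by omega
          rw [mem_quadOf_iff (by simp only [Fin.lt_def]; omega),
            mem_quadOf_iff (by simp only [Fin.lt_def]; omega)] at this
          simp only [Fin.ext_iff, e1, e2, hc, hd, ha, hb] at this
          have c1 : 2 * u + 1 < 2 * v + 1 := by omega
          have c2 : ¬ (2 * u = 0 ∧ 2 * v + 1 = 2 * n + 1) := by omega
          have c3 : 2 * u % 2 = 0 ∧ (2 * v + 1) % 2 = 1 := by omega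
          have c4 : (2 * u = 2 * x ∧ 2 * v + 1 = 2 * y + 1) ↔ (u = x ∧ v = y) := by omega
          have c5 : (2 * u = 2 * x' ∧ 2 * v + 1 = 2 * y' + 1) ↔ (u = x' ∧ v = y') := by omega
          rw [c4, c5] at this
          simpa only [c1, c2, c3.1, c3.2, true_and, not_false_eq_true] using this
    · refine iff_of_false (fun h => ?_) ?_
      · have := h.bounds; omega
      · rintro (h | h)
        · have := h.1.bounds; omega
        · omega
  · intro h u v huv
    rw [mem_quadOf_iff huv, mem_quadOf_iff huv, h]
    rw [Fin.lt_def] at huv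
    simp only [Fin.ext_iff, hc, hd, ha, hb]
    generalize IsSpan t 0 (u.val / 2) (v.val / 2) = A
    by_cases hA : A
    · simp only [hA, true_and, and_true]; omega
    · simp only [hA, false_and, and_false, false_or]; omega

theorem orientedFlip_iff_exists_rotatesAt {R R' : CompatibleQuad (catalanQuad n)}
    {t t' : BinaryTree Unit} (ht : t.numNodes = n) (ht' : t'.numNodes = n)
    (hR : R.1 = quadOf n t) (hR' : R'.1 = quadOf n t') :
    OrientedFlip R R' ↔ ∃ p r s q, RotatesAt (IsSpan t 0) (IsSpan t' 0) p r s q := by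
  unfold OrientedFlip
  rw [hR, hR']
  constructor
  · rintro ⟨a₀, b₀, a₁, b₁, a₂, b₂, ⟨w0, w1, w2⟩, ⟨k0, k1, k2⟩, ⟨c1, c2, c3, c4⟩,
      ⟨e1, e2, e3, e4, e5, e6⟩, ⟨w, b, hw, hb, ⟨m, hm1, hm2, hwb⟩, c5, c6⟩, hmem, heq⟩
    -- Every inner blue edge has `0` as its white end.
    have hw0 : w.val = 0 := by
      rcases Sym2.eq_iff.1 hwb with ⟨rfl, -⟩ | ⟨rfl, -⟩
      · rfl
      · simp only [IsWhite] at hw; omega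
    simp only [Cw, Fin.lt_def, red, blue, IsWhite, IsBlack] at *
    -- The blue vertex `0` lies clockwise between `b₁` and `a₂`, so the linear order of the hexagon
    -- starts at `a₂`.
    have o1 : a₂.val < b₂.val ∧ b₂.val < a₀.val ∧ a₀.val < b₀.val ∧ b₀.val < a₁.val ∧
      a₁.val < b₁.val := by omega
    obtain ⟨o1, o2, o3, o4, o5⟩ := o1
    have s1 := isSpan_of_isEdge ht o3 w0 k0 e1
    have s2 := eq_succ_of_isEdge ht o4 k0 e2
    have s3 := isSpan_of_isEdge ht o5 w1 k1 e3
    have s4 := isSpan_of_isEdge ht (by rw [Fin.lt_def]; omega) w2 k1 e4.symm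
    have s5 := isSpan_of_isEdge ht o1 w2 k2 e5
    have s6 := eq_succ_of_isEdge ht o2 k2 e6
    have s7 := isSpan_of_isEdge ht (by rw [Fin.lt_def]; omega) w2 k0 (Or.inl hmem)
    have hb₁ := b₁.isLt
    have x1 : a₀.val / 2 = b₂.val / 2 + 1 := by omega
    have x2 : a₁.val / 2 = b₀.val / 2 + 1 := by omega
    rw [x1] at s1
    rw [x2] at s3
    rw [quadOf_eq_exchange_iff ht ht' (x := a₂.val / 2) (y := b₀.val / 2) (x' := b₂.val / 2 + 1)
      (y' := b₁.val / 2) (by omega) (by omega) (by omega) (by omega) (by omega) (by omega)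
      (by omega) (by omega)] at heq
    exact ⟨_, _, _, _, ⟨by omega, by omega, by omega, s4, s7, s5, s1, s3, heq⟩⟩
  · rintro ⟨p, r, s, q, h⟩
    have h1 := h.le
    have h2 := h.lt
    have h3 := h.lt'
    have hq := h.outer.bounds
    -- In linear order the hexagon is `2 p, 2 r + 1, 2 r + 2, 2 s + 1, 2 s + 2, 2 q + 1`, beginning
    -- with `a₂`. The long edge is `0 → 2 s + 1`: its end has position `4 s + 2`, between the red
    -- positions `4 r + 5` of `a₀` and `4 s + 3` of `b₀`.
    refine ⟨⟨2 * (r + 1), by omega⟩, ⟨2 * s + 1, by omega⟩, ⟨2 * (s + 1), by omega⟩,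
      ⟨2 * q + 1, by omega⟩, ⟨2 * p, by omega⟩, ⟨2 * r + 1, by omega⟩, ?_, ?_, ?_,
      ⟨isEdge_of_isSpan ht h2 rfl rfl h.middle, isEdge_of_succ rfl,
        isEdge_of_isSpan ht h3 rfl rfl h.right,
        (isEdge_of_isSpan ht (by omega) rfl rfl h.outer).symm,
        isEdge_of_isSpan ht h1 rfl rfl h.left, isEdge_of_succ rfl⟩,
      ⟨0, ⟨2 * s + 1, by omega⟩, ?_, ?_, ⟨s, by omega, by omega, rfl⟩, ?_, ?_⟩,
      mem_quadOf_of_isSpan (by omega) (by omega) rfl rfl h.old, ?_⟩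
    · simp only [IsWhite]; omega
    · simp only [IsBlack]; omega
    · simp only [Cw, Fin.lt_def]; omega
    · simp [IsWhite]
    · simp only [IsBlack]; omega
    · simp only [Cw, red, blue, Fin.val_zero]; omega
    · simp only [Cw, red, blue]; omega
    · exact (quadOf_eq_exchange_iff ht ht' rfl rfl rfl rfl (by omega) (by omega) (by omega)
        (by omega)).2 h.iff

theorem orientedFlip_iff_rotation (R R' : CompatibleQuad (catalanQuad n)) :
    OrientedFlip R R' ↔ Rotation (binaryTreeEquiv n R).1 (binaryTreeEquiv n R').1 := by
  have ht := (binaryTreeEquiv n R).2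
  have ht' := (binaryTreeEquiv n R').2
  rw [orientedFlip_iff_exists_rotatesAt ht ht' (quadOf_binaryTreeEquiv R).symm
    (quadOf_binaryTreeEquiv R').symm]
  constructor
  · rintro ⟨p, r, s, q, h⟩
    exact rotation_of_rotatesAt (ht.trans ht'.symm) h
  · exact fun h => h.exists_rotatesAt 0

theorem OrientedFlip.isFlip {R R' : CompatibleQuad (catalanQuad n)} (h : OrientedFlip R R') :
    IsFlip R R' ∧ IsFlip R' R := by
  have ht := (binaryTreeEquiv n R).2
  have ht' := (binaryTreeEquiv n R').2
  obtain ⟨p, r, s, q, h⟩ := (orientedFlip_iff_exists_rotatesAt ht ht'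
    (quadOf_binaryTreeEquiv R).symm (quadOf_binaryTreeEquiv R').symm).1 h
  have h1 := h.le
  have h2 := h.lt
  have h3 := h.lt'
  have hq := h.outer.bounds
  have hlt : p < s := by omega
  have hlt' : r + 1 < q := by omega
  have hne : ¬ (p = 0 ∧ s = n) := by omega
  have hne' : ¬ (r + 1 = 0 ∧ q = n) := by omega
  let a : Fin (2 * n + 2) := ⟨2 * (r + 1), by omega⟩
  let b : Fin (2 * n + 2) := ⟨2 * q + 1, by omega⟩
  let c : Fin (2 * n + 2) := ⟨2 * p, by omega⟩
  let d : Fin (2 * n + 2) := ⟨2 * s + 1, by omega⟩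
  have hnew : s(a, b) ∉ R.1 := by
    rw [← quadOf_binaryTreeEquiv R]
    intro hmem
    have := isSpan_of_isEdge ht (by simp only [a, b, Fin.lt_def]; omega)
      (by simp only [a]; omega) (by simp only [b]; omega) (Or.inl hmem)
    -- The diagonals `[p, s]` and `[r + 1, q]` cross, so they are not both spans of one tree.
    have := h.old.noncrossing this (by simp only [a]; omega) (by simp only [a]; omega)
    simp only [b] at this
    omega
  have hold : s(c, d) ∈ R.1 := by
    rw [← quadOf_binaryTreeEquiv R]
    exact mem_quadOf_of_isSpan hlt hne rfl rfl h.old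
  have heq : R'.1 = insert s(a, b) (R.1 \ {s(c, d)}) := by
    rw [← quadOf_binaryTreeEquiv R, ← quadOf_binaryTreeEquiv R']
    exact (quadOf_eq_exchange_iff ht ht' rfl rfl rfl rfl hlt hlt' hne hne').2 h.iff
  have hab : s(a, b) ≠ s(c, d) := fun e => hnew (e ▸ hold)
  refine ⟨⟨_, hold, _, hnew, heq⟩, _, heq ▸ Set.mem_insert _ _, s(c, d), ?_, ?_⟩
  · rw [heq]
    rintro (e | e)
    · exact hab e.symm
    · exact e.2 rfl
  · rw [heq]
    ext e
    simp only [Set.mem_insert_iff, Set.mem_sdiff, Set.mem_singleton_iff]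
    grind

theorem isFlip_iff_rotation (R R' : CompatibleQuad (catalanQuad n)) :
    IsFlip R R' ↔ Rotation (binaryTreeEquiv n R).1 (binaryTreeEquiv n R').1 ∨
      Rotation (binaryTreeEquiv n R').1 (binaryTreeEquiv n R).1 := by
  constructor
  · rintro ⟨i, hi, j, hj, heq⟩
    have ht := (binaryTreeEquiv n R).2
    have ht' := (binaryTreeEquiv n R').2
    have hj' : j ∈ R'.1 := heq ▸ Set.mem_insert _ _
    rw [← quadOf_binaryTreeEquiv R] at hi hj heq
    rw [← quadOf_binaryTreeEquiv R'] at hj' heq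
    obtain ⟨c, d, i1, i2, ⟨i3, i4, i5⟩, rfl⟩ := hi
    obtain ⟨a, b, j1, j2, ⟨j3, j4, j5⟩, rfl⟩ := hj'
    rw [quadOf_eq_exchange_iff ht ht' (x := c.val / 2) (y := d.val / 2) (x' := a.val / 2)
      (y' := b.val / 2) (by omega) (by omega) (by omega) (by omega) (by omega) (by omega)
      (by omega) (by omega)] at heq
    refine rotation_or_rotation_of_exchange (ht.trans ht'.symm) (by omega) (by omega) i5
      (fun h => hj ?_) heq
    exact mem_quadOf_of_isSpan (by omega) (by omega) (by omega) (by omega) h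
  · rintro (h | h)
    · exact ((orientedFlip_iff_rotation R R').2 h).isFlip.1
    · exact ((orientedFlip_iff_rotation R' R).2 h).isFlip.2

theorem le_iff_reflTransGen_rotation (R R' : CompatibleQuad (catalanQuad n)) :
    R ≤ R' ↔ binaryTreeEquiv n R' ≤ binaryTreeEquiv n R := by
  constructor
  · intro h
    exact Relation.ReflTransGen.lift (r := OrientedFlip)
      (p := fun x y : Tamari n => Rotation x.1 y.1) (binaryTreeEquiv n)
      (fun R R' h => (orientedFlip_iff_rotation R R').1 h) _ _ h
  · intro h
    have : Relation.ReflTransGen OrientedFlip ((binaryTreeEquiv n).symm (binaryTreeEquiv n R'))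
        ((binaryTreeEquiv n).symm (binaryTreeEquiv n R)) :=
      Relation.ReflTransGen.lift (r := fun x y : Tamari n => Rotation x.1 y.1) (p := OrientedFlip)
        (binaryTreeEquiv n).symm
        (fun t t' h => (orientedFlip_iff_rotation _ _).2 (by simpa using h)) _ _ h
    rwa [Equiv.symm_apply_apply, Equiv.symm_apply_apply] at this

end Flips

/-! ### Left and right branches -/

section Branches

variable {n : ℕ}

/-- The spans around a square of the quadrangulation of a binary tree. -/
theorem isSpan_of_isRegion {t : BinaryTree Unit} (ht : t.numNodes = n) {i k l j : Fin (2 * n + 2)}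
    (hik : i < k) (hkl : k < l) (hlj : l < j) (h : IsRegion (quadOf n t) {i, k, l, j}) :
    (i.val % 2 = 0 ∧ k.val % 2 = 1 ∧ l.val = k.val + 1 ∧ j.val % 2 = 1) ∧
      IsSpan t 0 (i.val / 2) (k.val / 2) ∧ IsSpan t 0 (k.val / 2 + 1) (j.val / 2) ∧
      IsSpan t 0 (i.val / 2) (j.val / 2) := by
  obtain ⟨⟨h1, h2, h3, h4⟩, -⟩ := (isRegion_square_iff hik hkl hlj).1 h
  have hij := hik.trans (hkl.trans hlj)
  have h4' := (isEdge_quadOf_iff ht hij).1 h4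
  have h1' := (isEdge_quadOf_iff ht hik).1 h1
  have hi : i.val % 2 = 0 ∧ j.val % 2 = 1 := by rw [Fin.lt_def] at *; omega
  have hk : k.val % 2 = 1 := by omega
  have hl := eq_succ_of_isEdge ht hkl hk h2
  have e : l.val / 2 = k.val / 2 + 1 := by omega
  refine ⟨⟨hi.1, hk, hl, hi.2⟩, isSpan_of_isEdge ht hik hi.1 hk h1, ?_,
    isSpan_of_isEdge ht hij hi.1 hi.2 h4⟩
  rw [← e]
  exact isSpan_of_isEdge ht hlj (by omega) hi.2 h3

theorem exists_orientedFlip_from_iff (R : CompatibleQuad (catalanQuad n))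
    {i : Sym2 (Fin (2 * n + 2))} (hi : i ∈ R.1) :
    (∃ R', OrientedFlip R R' ∧ i ∉ R'.1) ↔ IsLeftBranch R.1 i := by
  have ht := (binaryTreeEquiv n R).2
  have hR := quadOf_binaryTreeEquiv R
  have hi' := hi
  rw [← hR] at hi'
  obtain ⟨a, b, i1, i2, ⟨i3, i4, i5⟩, rfl⟩ := hi'
  constructor
  · rintro ⟨R', hflip, hnot⟩
    have ht' := (binaryTreeEquiv n R').2
    obtain ⟨p, r, s, q, h⟩ := (orientedFlip_iff_exists_rotatesAt ht ht' hR.symm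
      (quadOf_binaryTreeEquiv R').symm).1 hflip
    have h3 := h.lt'
    have hq := h.outer.bounds
    have hps : a.val / 2 = p ∧ b.val / 2 = s := by
      by_contra hne
      refine hnot ?_
      rw [← quadOf_binaryTreeEquiv R']
      exact mem_quadOf_of_isSpan (by omega) (by omega) (by omega) (by omega)
        ((h.iff _ _).2 (Or.inl ⟨i5, hne⟩))
    refine ⟨hi, a, b, ⟨2 * s + 2, by omega⟩, ⟨2 * q + 1, by omega⟩, by rw [Fin.lt_def]; omega,
      by simp only [Fin.lt_def]; omega, by simp only [Fin.lt_def]; omega, ?_, rfl⟩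
    rw [← hR]
    exact isRegion_quadOf ht (by omega) h3 h.outer h.old h.right (by omega) (by omega) rfl rfl
  · rintro ⟨-, i, k, l, j, hik, hkl, hlj, hreg, e⟩
    rw [sym2_eq_iff_of_lt (by rw [Fin.lt_def]; omega) hik] at e
    obtain ⟨rfl, rfl⟩ := e
    rw [← hR] at hreg
    obtain ⟨⟨e1, e2, e3, e4⟩, s1, s2, s3⟩ := isSpan_of_isRegion ht hik hkl hlj hreg
    -- An inner edge is not a leaf, so the left child splits again; this gives the three subtrees
    -- that a rotation needs.
    obtain ⟨r, hr1, hr2, hl, hm⟩ := s1.exists_split (by omega)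
    rw [Fin.lt_def] at *
    obtain ⟨t', hrot, h⟩ := exists_rotation hr1 hr2 (by omega) s3 s1 hl hm s2
    have ht' : t'.numNodes = n := hrot.numNodes_eq.symm.trans ht
    refine ⟨compatibleOf ⟨t', ht'⟩,
      (orientedFlip_iff_exists_rotatesAt ht ht' hR.symm rfl).2 ⟨_, _, _, _, h⟩, fun hmem => ?_⟩
    have := ((mem_quadOf_iff (by rw [Fin.lt_def]; omega)).1 hmem).2.2.2.2
    rw [h.iff] at this
    omega

theorem exists_orientedFlip_to_iff (R : CompatibleQuad (catalanQuad n))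
    {i : Sym2 (Fin (2 * n + 2))} (hi : i ∈ R.1) :
    (∃ R', OrientedFlip R' R ∧ i ∉ R'.1) ↔ IsRightBranch R.1 i := by
  have ht := (binaryTreeEquiv n R).2
  have hR := quadOf_binaryTreeEquiv R
  have hi' := hi
  rw [← hR] at hi'
  obtain ⟨a, b, i1, i2, ⟨i3, i4, i5⟩, rfl⟩ := hi'
  constructor
  · rintro ⟨R', hflip, hnot⟩
    have ht' := (binaryTreeEquiv n R').2
    obtain ⟨p, r, s, q, h⟩ := (orientedFlip_iff_exists_rotatesAt ht' ht
      (quadOf_binaryTreeEquiv R').symm hR.symm).1 hflip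
    have h1 := h.le
    have h2 := h.lt
    have h3 := h.lt'
    have hq := h.outer.bounds
    have hrq : a.val / 2 = r + 1 ∧ b.val / 2 = q := by
      rcases (h.iff _ _).1 i5 with h' | h'
      · refine absurd ?_ hnot
        rw [← quadOf_binaryTreeEquiv R']
        exact mem_quadOf_of_isSpan (by omega) (by omega) (by omega) (by omega) h'.1
      · exact h'
    refine ⟨hi, ⟨2 * p, by omega⟩, ⟨2 * r + 1, by omega⟩, a, b, by simp only [Fin.lt_def]; omega,
      by simp only [Fin.lt_def]; omega, by simp only [Fin.lt_def]; omega, ?_, rfl⟩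
    rw [← hR]
    refine isRegion_quadOf ht (p := p) (r := r) (q := q) (by omega) (by omega)
      ((h.iff _ _).2 (Or.inl ⟨h.outer, by omega⟩)) ((h.iff _ _).2 (Or.inl ⟨h.left, by omega⟩))
      ((h.iff _ _).2 (Or.inr ⟨rfl, rfl⟩)) rfl rfl (by omega) (by omega)
  · rintro ⟨-, i, k, l, j, hik, hkl, hlj, hreg, e⟩
    rw [sym2_eq_iff_of_lt (by rw [Fin.lt_def]; omega) hlj] at e
    obtain ⟨rfl, rfl⟩ := e
    rw [← hR] at hreg
    obtain ⟨⟨e1, e2, e3, e4⟩, s1, s2, s3⟩ := isSpan_of_isRegion ht hik hkl hlj hreg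
    rw [Fin.lt_def] at *
    -- The right child splits again, which is the pattern for an inverse rotation.
    obtain ⟨s, hs1, hs2, hl, hm⟩ := s2.exists_split (by omega)
    obtain ⟨t', hrot, h⟩ := exists_rotation_to (by omega) hs1 hs2 s3 s1 s2 hl hm
    have ht' : t'.numNodes = n := hrot.numNodes_eq.trans ht
    refine ⟨compatibleOf ⟨t', ht'⟩,
      (orientedFlip_iff_exists_rotatesAt ht' ht rfl hR.symm).2 ⟨_, _, _, _, h⟩, fun hmem => ?_⟩
    have hs := ((mem_quadOf_iff (by rw [Fin.lt_def]; omega)).1 hmem).2.2.2.2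
    have := h.old.noncrossing hs (by omega) (by omega)
    omega

end Branches

end Stokes

namespace Stokes

/-! ### Bracket vectors and the lattice property -/

section TamariLattice

/-- The last leaf of the largest subtree of `t` whose first leaf is the leaf `i`; the leaves of `t`
are numbered from left to right, starting with `0`. -/
def reach : BinaryTree Unit → ℕ → ℕ
  | .nil, _ => 0
  | .node _ l r, i =>
    if i = 0 then l.numNodes + r.numNodes + 1
    else if i ≤ l.numNodes then reach l i
    else reach r (i - (l.numNodes + 1)) + (l.numNodes + 1)

theorem reach_zero (t : BinaryTree Unit) : reach t 0 = t.numNodes := by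
  cases t <;> simp [reach, BinaryTree.numNodes]

theorem reach_node_zero (l r : BinaryTree Unit) :
    reach (.node () l r) 0 = l.numNodes + r.numNodes + 1 := by simp [reach]

theorem reach_node_left (l r : BinaryTree Unit) {i : ℕ} (h : 0 < i) (h' : i ≤ l.numNodes) :
    reach (.node () l r) i = reach l i := by
  rw [reach, if_neg (by omega), if_pos h']

theorem reach_node_right (l r : BinaryTree Unit) {i : ℕ} (h : l.numNodes < i) :
    reach (.node () l r) i = reach r (i - (l.numNodes + 1)) + (l.numNodes + 1) := by
  rw [reach, if_neg (by omega), if_neg (by omega)]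

theorem reach_node_succ (l r : BinaryTree Unit) :
    reach (.node () l r) (l.numNodes + 1) = l.numNodes + r.numNodes + 1 := by
  rw [reach_node_right _ _ (by omega), Nat.sub_self, reach_zero]
  omega

theorem reach_bounds (t : BinaryTree Unit) {i : ℕ} (h : i ≤ t.numNodes) :
    i ≤ reach t i ∧ reach t i ≤ t.numNodes := by
  induction t generalizing i with
  | nil => simpa [BinaryTree.numNodes, reach] using h
  | node _ l r ihl ihr =>
    simp only [BinaryTree.numNodes] at *
    rcases Nat.eq_zero_or_pos i with rfl | hi
    · rw [reach_node_zero]; omega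
    · rcases Nat.lt_or_ge l.numNodes i with h' | h'
      · rw [reach_node_right _ _ h']
        have := ihr (i := i - (l.numNodes + 1)) (by omega)
        omega
      · rw [reach_node_left _ _ hi h']
        have := ihl h'
        omega

theorem reach_nested (t : BinaryTree Unit) {i j : ℕ} (h : i < j) (hj : j ≤ reach t i)
    (hi : i ≤ t.numNodes) : reach t j ≤ reach t i := by
  induction t generalizing i j with
  | nil => simp only [reach] at *; omega
  | node _ l r ihl ihr =>
    have hb := reach_bounds (.node () l r) hi
    have hb' := reach_bounds (.node () l r) (hj.trans hb.2)
    simp only [BinaryTree.numNodes] at hi hb hb'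
    rcases Nat.eq_zero_or_pos i with rfl | hi0
    · rw [reach_node_zero]; exact hb'.2
    · rcases Nat.lt_or_ge l.numNodes i with h' | h'
      · rw [reach_node_right _ _ h'] at *
        rw [reach_node_right _ _ (by omega)]
        have := ihr (i := i - (l.numNodes + 1)) (j := j - (l.numNodes + 1)) (by omega) (by omega)
          (by omega)
        omega
      · rw [reach_node_left _ _ hi0 h'] at *
        have := reach_bounds l h'
        rw [reach_node_left _ _ (by omega) (by omega)]
        exact ihl h hj h'

/-- Only the first leaf of the middle subtree `b` is affected: the largest subtree starting there
grows from `b` to `(b c)`. -/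
theorem Rotation.reach_le {s t : BinaryTree Unit} (h : Rotation s t) {i : ℕ}
    (hi : i ≤ s.numNodes) : reach s i ≤ reach t i := by
  induction h generalizing i with
  | root a b c =>
    have hn := reach_bounds (.node () (.node () a b) c) hi
    simp only [BinaryTree.numNodes] at hi hn
    rcases Nat.eq_zero_or_pos i with rfl | hi0
    · rw [reach_zero, reach_zero]; simp only [BinaryTree.numNodes]; omega
    · rcases Nat.lt_or_ge a.numNodes i with h1 | h1
      · rw [reach_node_right a _ h1]
        rcases Nat.eq_or_lt_of_le h1 with h1 | h1
        · obtain rfl : i = a.numNodes + 1 := h1.symm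
          rw [Nat.sub_self, reach_zero]
          simp only [BinaryTree.numNodes]
          omega
        · rcases Nat.lt_or_ge (a.numNodes + b.numNodes + 1) i with h2 | h2
          · rw [reach_node_right _ _ (by simpa [BinaryTree.numNodes] using h2),
              reach_node_right _ _ (by omega)]
            simp only [BinaryTree.numNodes]
            have e : i - (a.numNodes + b.numNodes + 1 + 1) =
              i - (a.numNodes + 1) - (b.numNodes + 1) := by omega
            rw [e]
            omega
          · rw [reach_node_left _ _ hi0 (by simpa [BinaryTree.numNodes] using h2),
              reach_node_right _ _ (by omega), reach_node_left _ _ (by omega) (by omega)]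
      · rw [reach_node_left _ _ hi0 (by simp only [BinaryTree.numNodes]; omega),
          reach_node_left _ _ hi0 h1, reach_node_left _ _ hi0 h1]
  | left a a' b h ih =>
    simp only [BinaryTree.numNodes] at hi
    have hn := h.numNodes_eq
    rcases Nat.eq_zero_or_pos i with rfl | hi0
    · rw [reach_node_zero, reach_node_zero, hn]
    · rcases Nat.lt_or_ge a.numNodes i with h1 | h1
      · rw [reach_node_right _ _ h1, reach_node_right _ _ (by omega), hn]
      · rw [reach_node_left _ _ hi0 h1, reach_node_left _ _ hi0 (by omega)]
        exact ih h1
  | right a b b' h ih =>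
    simp only [BinaryTree.numNodes] at hi
    have hn := h.numNodes_eq
    rcases Nat.eq_zero_or_pos i with rfl | hi0
    · rw [reach_node_zero, reach_node_zero, hn]
    · rcases Nat.lt_or_ge a.numNodes i with h1 | h1
      · rw [reach_node_right _ _ h1, reach_node_right _ _ h1]
        exact Nat.add_le_add_right (ih (by omega)) _
      · rw [reach_node_left _ _ hi0 h1, reach_node_left _ _ hi0 h1]

theorem reflTransGen_rotation_numNodes {s t : BinaryTree Unit}
    (h : Relation.ReflTransGen Rotation s t) : s.numNodes = t.numNodes := by
  induction h with
  | refl => rfl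
  | tail _ h ih => exact ih.trans h.numNodes_eq

theorem reach_le_of_reflTransGen {s t : BinaryTree Unit} (h : Relation.ReflTransGen Rotation s t)
    {i : ℕ} (hi : i ≤ s.numNodes) : reach s i ≤ reach t i := by
  induction h with
  | refl => exact le_rfl
  | tail h h' ih =>
    exact ih.trans (h'.reach_le (by rwa [← reflTransGen_rotation_numNodes h]))

theorem reflTransGen_node {a a' b b' : BinaryTree Unit} (ha : Relation.ReflTransGen Rotation a a')
    (hb : Relation.ReflTransGen Rotation b b') :
    Relation.ReflTransGen Rotation (.node () a b) (.node () a' b') :=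
  (Relation.ReflTransGen.lift (fun x => BinaryTree.node () x b)
    (fun _ _ h => Rotation.left _ _ _ h) _ _ ha).trans
    (Relation.ReflTransGen.lift (fun x => BinaryTree.node () a' x)
      (fun _ _ h => Rotation.right _ _ _ h) _ _ hb)

/-- A tree can be rotated so that its left subtree has a given number `k` of nodes, if no subtree
starting at one of the leaves `1, …, k` extends beyond the leaf `k`. -/
theorem exists_rotations_to_split {s : BinaryTree Unit} {k : ℕ} (hk : k < s.numNodes)
    (h : ∀ i, 0 < i → i ≤ k → reach s i ≤ k) :
    ∃ x y : BinaryTree Unit, x.numNodes = k ∧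
      Relation.ReflTransGen Rotation s (.node () x y) ∧
      ∀ i, 0 < i → i ≤ s.numNodes → i ≠ k + 1 → reach (.node () x y) i = reach s i := by
  induction s with
  | nil => simp [BinaryTree.numNodes] at hk
  | node _ a b iha _ =>
    rcases lt_trichotomy a.numNodes k with hlt | heq | hlt
    -- The first leaf of the right subtree would be at most `k`, yet it reaches the last leaf of
    -- `s`.
    · have := h _ (Nat.succ_pos _) hlt
      rw [Nat.succ_eq_add_one, reach_node_succ] at this
      simp only [BinaryTree.numNodes] at hk
      omega
    · exact ⟨a, b, heq, .refl, fun _ _ _ _ => rfl⟩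
    -- Split the left subtree as `(x y)` first; a rotation at the root then moves `y` to the right.
    · obtain ⟨x, y, hx, hrot, hreach⟩ := iha hlt fun i h0 hi => by
        have := h i h0 hi
        rwa [reach_node_left _ _ h0 (by omega)] at this
      have hn := reflTransGen_rotation_numNodes hrot
      simp only [BinaryTree.numNodes] at hn
      refine ⟨x, .node () y b, hx,
        (reflTransGen_node hrot .refl).tail (Rotation.root x y b), fun i h0 hi hik => ?_⟩
      rcases Nat.lt_or_ge a.numNodes i with h1 | h1
      · rw [reach_node_right _ _ (by omega), reach_node_right _ _ (by omega),
          reach_node_right _ _ h1]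
        have e : i - (x.numNodes + 1) - (y.numNodes + 1) = i - (a.numNodes + 1) := by omega
        rw [e]
        omega
      · rw [reach_node_left a _ h0 h1, ← hreach i h0 h1 hik]
        rcases Nat.lt_or_ge k i with h2 | h2
        · rw [reach_node_right x _ (by omega), reach_node_right x y (by omega),
            reach_node_left y b (by omega) (by omega)]
        · rw [reach_node_left _ _ h0 (by omega), reach_node_left _ _ h0 (by omega)]

/-- Since the vector of `s` is below that of `t = (c d)`, `s` can be rotated to a tree split like
`t`. This changes the vector only at the first leaf of the right subtree, where its value is maximal
anyway, so the inequalities pass to both subtrees. -/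
theorem reflTransGen_of_reach_le {s t : BinaryTree Unit} (hn : s.numNodes = t.numNodes)
    (h : ∀ i ≤ s.numNodes, reach s i ≤ reach t i) : Relation.ReflTransGen Rotation s t := by
  induction t generalizing s with
  | nil =>
    cases s with
    | nil => exact .refl
    | node => simp [BinaryTree.numNodes] at hn
  | node _ c d ihc ihd =>
    simp only [BinaryTree.numNodes] at hn
    obtain ⟨x, y, hx, hrot, hreach⟩ := exists_rotations_to_split (s := s) (k := c.numNodes)
      (by omega) fun i h0 hi => by
        have h1 := h i (by omega)
        rw [reach_node_left _ _ h0 hi] at h1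
        exact h1.trans (reach_bounds c hi).2
    have hn' := reflTransGen_rotation_numNodes hrot
    simp only [BinaryTree.numNodes] at hn'
    refine hrot.trans (reflTransGen_node (ihc hx fun i hi => ?_) (ihd (by omega) fun i hi => ?_))
    · rcases Nat.eq_zero_or_pos i with rfl | h0
      · rw [reach_zero, reach_zero, hx]
      · have h1 := hreach i h0 (by omega) (by omega)
        have h2 := h i (by omega)
        rw [reach_node_left _ _ h0 hi] at h1
        rw [reach_node_left _ _ h0 (by omega)] at h2
        omega
    · rcases Nat.eq_zero_or_pos i with rfl | h0
      · rw [reach_zero, reach_zero]; omega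
      · have h1 := hreach (i + (c.numNodes + 1)) (by omega) (by omega) (by omega)
        have h2 := h (i + (c.numNodes + 1)) (by omega)
        rw [reach_node_right _ _ (by omega), hx, Nat.add_sub_cancel] at h1
        rw [reach_node_right _ _ (by omega), Nat.add_sub_cancel] at h2
        omega

/-- A function with the formal properties of `reach` comes from a tree. -/
theorem exists_tree_of_reach {m : ℕ} {v : ℕ → ℕ} (h0 : v 0 = m)
    (hb : ∀ i ≤ m, i ≤ v i ∧ v i ≤ m) (hv : ∀ i j, i < j → j ≤ v i → i ≤ m → v j ≤ v i) :
    ∃ t : BinaryTree Unit, t.numNodes = m ∧ ∀ i ≤ m, reach t i = v i := by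
  induction m using Nat.strong_induction_on generalizing v with
  | _ m ih =>
    rcases Nat.eq_zero_or_pos m with rfl | hm
    · refine ⟨.nil, rfl, fun i hi => ?_⟩
      obtain rfl : i = 0 := by omega
      simp [reach, h0]
    -- The right subtree must start at the first positive leaf that reaches `m`; the leaf `m` itself
    -- does, so one exists.
    · have hex : ∃ k, v (k + 1) = m := by
        refine ⟨m - 1, ?_⟩
        have := hb m le_rfl
        rw [Nat.sub_add_cancel hm]
        omega
      classical
      obtain ⟨k, hk, hmin⟩ : ∃ k, v (k + 1) = m ∧ ∀ j < k, v (j + 1) ≠ m :=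
        ⟨Nat.find hex, Nat.find_spec hex, fun j hj => Nat.find_min hex hj⟩
      have hkm : k < m := by
        by_contra hlt
        refine hmin (m - 1) (by omega) ?_
        have := hb m le_rfl
        rw [Nat.sub_add_cancel hm]
        omega
      have hle : ∀ i, 0 < i → i ≤ k → v i ≤ k := by
        intro i hi hik
        by_contra hlt
        have h1 := hv i (k + 1) (by omega) (by omega) (by omega)
        have h2 := hb i (by omega)
        refine hmin (i - 1) (by omega) ?_
        rw [Nat.sub_add_cancel hi]
        omega
      -- The value at `0` is reset to `k`, because within the left subtree the leaf `0` reaches only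
      -- the leaf `k`.
      obtain ⟨l, hl, hl'⟩ := ih k hkm (v := fun i => if i = 0 then k else v i) (by simp)
        (fun i hi => by
          split_ifs with e
          · omega
          · exact ⟨(hb i (by omega)).1, hle i (by omega) hi⟩)
        (fun i j hij hj hi => by
          simp only [if_neg (show j ≠ 0 by omega)]
          split_ifs at hj ⊢ with e
          · exact hle j (by omega) hj
          · exact hv i j hij hj (by omega))
      obtain ⟨r, hr, hr'⟩ := ih (m - (k + 1)) (by omega) (v := fun i => v (i + (k + 1)) - (k + 1))
        (by simp [hk])
        (fun i hi => by
          have := hb (i + (k + 1)) (by omega)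
          omega)
        (fun i j hij hj hi => by
          have := hv (i + (k + 1)) (j + (k + 1)) (by omega) (by omega) (by omega)
          omega)
      refine ⟨.node () l r, by simp only [BinaryTree.numNodes]; omega, fun i hi => ?_⟩
      rcases Nat.eq_zero_or_pos i with rfl | hi0
      · rw [reach_node_zero]; omega
      · rcases Nat.lt_or_ge k i with h1 | h1
        · have := hb i hi
          rw [reach_node_right _ _ (by omega), hl, hr' _ (by omega)]
          simp only [Nat.sub_add_cancel (show k + 1 ≤ i from h1)]
          omega
        · rw [reach_node_left _ _ hi0 (by omega), hl' i h1, if_neg (by omega)]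

/-- Rotations preserve the number of nodes, so a chain of rotations between arbitrary trees never
leaves `Tamari n`. -/
theorem tamari_le_iff {n : ℕ} {s t : Tamari n} :
    s ≤ t ↔ Relation.ReflTransGen Rotation s.1 t.1 := by
  refine ⟨fun h => Relation.ReflTransGen.lift Subtype.val (fun _ _ h => h) _ _ h, fun h => ?_⟩
  obtain ⟨t, ht⟩ := t
  have key : ∀ u : BinaryTree Unit, Relation.ReflTransGen Rotation s.1 u →
      ∀ hu : u.numNodes = n, s ≤ (⟨u, hu⟩ : Tamari n) := by
    intro u h
    induction h with
    | refl => exact fun _ => Relation.ReflTransGen.refl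
    | tail _ h' ih =>
      exact fun hu => Relation.ReflTransGen.tail (ih (h'.numNodes_eq.trans hu)) h'
  exact key t h ht

theorem tamari_le_iff_reach {n : ℕ} {s t : Tamari n} :
    s ≤ t ↔ ∀ i ≤ n, reach s.1 i ≤ reach t.1 i := by
  rw [tamari_le_iff]
  constructor
  · intro h i hi
    exact reach_le_of_reflTransGen h (by rwa [s.2])
  · intro h
    exact reflTransGen_of_reach_le (s.2.trans t.2.symm) fun i hi => h i (by rwa [s.2] at hi)

/-- The bounds and the nesting property that characterize bracket vectors are stable under pointwise
minimum. They are not stable under maximum, which is why joins go through reflection. -/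
theorem tamari_exists_isGLB {n : ℕ} (s t : Tamari n) : ∃ u, IsGLB {s, t} u := by
  obtain ⟨u, hu, hu'⟩ := exists_tree_of_reach (m := n) (v := fun i => min (reach s.1 i) (reach t.1 i))
    (by simp [reach_zero, s.2, t.2])
    (fun i hi => by
      have h1 := reach_bounds s.1 (i := i) (by rwa [s.2])
      have h2 := reach_bounds t.1 (i := i) (by rwa [t.2])
      have := s.2
      have := t.2
      omega)
    (fun i j hij hj hi => by
      have h1 := reach_nested s.1 hij (hj.trans (min_le_left _ _)) (by rwa [s.2])
      have h2 := reach_nested t.1 hij (hj.trans (min_le_right _ _)) (by rwa [t.2])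
      exact min_le_min h1 h2)
  refine ⟨⟨u, hu⟩, ?_, fun w hw => ?_⟩
  · rintro x (rfl | rfl)
    · exact tamari_le_iff_reach.2 fun i hi => (hu' i hi).trans_le (min_le_left _ _)
    · exact tamari_le_iff_reach.2 fun i hi => (hu' i hi).trans_le (min_le_right _ _)
  · refine tamari_le_iff_reach.2 fun i hi => ?_
    rw [hu' i hi]
    exact le_min (tamari_le_iff_reach.1 (hw (Set.mem_insert _ _)) i hi)
      (tamari_le_iff_reach.1 (hw (Set.mem_insert_of_mem _ rfl)) i hi)

/-- Reflection of binary trees. -/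
def mirror : BinaryTree Unit → BinaryTree Unit
  | .nil => .nil
  | .node _ l r => .node () (mirror r) (mirror l)

theorem mirror_mirror (t : BinaryTree Unit) : mirror (mirror t) = t := by
  induction t with
  | nil => rfl
  | node _ l r ihl ihr => simp [mirror, ihl, ihr]

theorem numNodes_mirror (t : BinaryTree Unit) : (mirror t).numNodes = t.numNodes := by
  induction t with
  | nil => rfl
  | node _ l r ihl ihr => simp [mirror, BinaryTree.numNodes, ihl, ihr]; omega

theorem Rotation.mirror {s t : BinaryTree Unit} (h : Rotation s t) :
    Rotation (Stokes.mirror t) (Stokes.mirror s) := by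
  induction h with
  | root a b c => exact .root _ _ _
  | left a a' b h ih => exact .right _ _ _ ih
  | right a b b' h ih => exact .left _ _ _ ih

/-- Reflection of binary trees with `n` nodes. -/
def Tamari.mirror {n : ℕ} (t : Tamari n) : Tamari n :=
  ⟨Stokes.mirror t.1, (numNodes_mirror _).trans t.2⟩

theorem Tamari.mirror_mirror {n : ℕ} (t : Tamari n) : t.mirror.mirror = t :=
  Subtype.ext (Stokes.mirror_mirror t.1)

theorem Tamari.mirror_le_mirror {n : ℕ} {s t : Tamari n} (h : s ≤ t) : t.mirror ≤ s.mirror := by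
  rw [tamari_le_iff] at *
  exact Relation.reflTransGen_swap.1
    (Relation.ReflTransGen.lift Stokes.mirror (fun _ _ h => h.mirror) _ _ h)

/-- Reflection reverses the Tamari order. -/
def tamariMirror (n : ℕ) : Tamari n ≃o (Tamari n)ᵒᵈ where
  toFun t := OrderDual.toDual t.mirror
  invFun t := (OrderDual.ofDual t).mirror
  left_inv t := t.mirror_mirror
  right_inv t := (OrderDual.ofDual t).mirror_mirror
  map_rel_iff' {s t} := by
    refine ⟨fun h => ?_, Tamari.mirror_le_mirror⟩
    rw [← s.mirror_mirror, ← t.mirror_mirror]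
    exact Tamari.mirror_le_mirror h

theorem tamari_exists_isLUB {n : ℕ} (s t : Tamari n) : ∃ u, IsLUB {s, t} u := by
  obtain ⟨u, hu⟩ := tamari_exists_isGLB (OrderDual.ofDual (tamariMirror n s))
    (OrderDual.ofDual (tamariMirror n t))
  refine ⟨(tamariMirror n).symm (OrderDual.toDual u), ?_⟩
  rw [← (tamariMirror n).isLUB_image', Set.image_pair, OrderIso.apply_symm_apply]
  exact hu

theorem card_tamari (n : ℕ) : Nat.card (Tamari n) = catalan n := by
  rw [← BinaryTree.treesOfNumNodesEq_card_eq_catalan, ← Fintype.card_coe,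
    ← Nat.card_eq_fintype_card]
  exact Nat.card_congr (Equiv.subtypeEquivRight fun t => BinaryTree.mem_treesOfNumNodesEq.symm)

/-- The Stokes poset of the Catalan quadrangulation is dual to the Tamari lattice. -/
noncomputable def stokesIsoDual (n : ℕ) : CompatibleQuad (catalanQuad n) ≃o (Tamari n)ᵒᵈ where
  toEquiv := (binaryTreeEquiv n).trans OrderDual.toDual
  map_rel_iff' {R R'} := (le_iff_reflTransGen_rotation R R').symm

theorem exists_isLUB (n : ℕ) (R R' : CompatibleQuad (catalanQuad n)) :
    ∃ S, IsLUB {R, R'} S := by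
  obtain ⟨u, hu⟩ := tamari_exists_isGLB (binaryTreeEquiv n R) (binaryTreeEquiv n R')
  refine ⟨(stokesIsoDual n).symm (OrderDual.toDual u), ?_⟩
  rw [← (stokesIsoDual n).isLUB_image', Set.image_pair, OrderIso.apply_symm_apply]
  exact hu

theorem exists_isGLB (n : ℕ) (R R' : CompatibleQuad (catalanQuad n)) :
    ∃ S, IsGLB {R, R'} S := by
  obtain ⟨u, hu⟩ := tamari_exists_isLUB (binaryTreeEquiv n R) (binaryTreeEquiv n R')
  refine ⟨(stokesIsoDual n).symm (OrderDual.toDual u), ?_⟩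
  rw [← (stokesIsoDual n).isGLB_image', Set.image_pair, OrderIso.apply_symm_apply]
  exact hu

end TamariLattice

end Stokes

/-! ### The main theorem -/

theorem mainTheorem4 (n : ℕ) (hn : 1 ≤ n) :
    Stokes.IsQuadrangulation (Stokes.catalanQuad n) ∧
    (∃ (e : Stokes.CompatibleQuad (Stokes.catalanQuad n) ≃
          {T : Stokes.TernaryTree // T.numNodes = n ∧ T.NoMiddle})
        (f : Stokes.CompatibleQuad (Stokes.catalanQuad n) ≃ Stokes.Tamari n),
      (∀ R T, Stokes.IsDualTree R.1 T ↔ (e R).1 = T) ∧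
      (∀ R, (f R).1 = (e R).1.toBinary) ∧
      (∀ R R', Stokes.OrientedFlip R R' ↔ Stokes.Rotation (f R).1 (f R').1) ∧
      (∀ R R', Stokes.IsFlip R R' ↔
        Stokes.Rotation (f R).1 (f R').1 ∨ Stokes.Rotation (f R').1 (f R).1) ∧
      (∀ R R', R ≤ R' ↔ f R' ≤ f R)) ∧
    (∀ (R : Stokes.CompatibleQuad (Stokes.catalanQuad n)), ∀ i ∈ R.1,
      ((∃ R', Stokes.OrientedFlip R R' ∧ i ∉ R'.1) ↔ Stokes.IsLeftBranch R.1 i) ∧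
      ((∃ R', Stokes.OrientedFlip R' R ∧ i ∉ R'.1) ↔ Stokes.IsRightBranch R.1 i)) ∧
    Nonempty (Stokes.CompatibleQuad (Stokes.catalanQuad n) ≃o Stokes.Tamari n) ∧
    (∀ R R' : Stokes.CompatibleQuad (Stokes.catalanQuad n),
      (∃ S, IsLUB {R, R'} S) ∧ (∃ S, IsGLB {R, R'} S)) ∧
    Nat.card (Stokes.CompatibleQuad (Stokes.catalanQuad n)) = catalan n := by
  refine ⟨Stokes.isQuadrangulation_catalanQuad n,
    ⟨(Stokes.binaryTreeEquiv n).trans (Stokes.tamariEquivTernary n), Stokes.binaryTreeEquiv n,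
      fun R T => ?_, fun R => (Stokes.toBinary_toTernary _).symm,
      Stokes.orientedFlip_iff_rotation, Stokes.isFlip_iff_rotation,
      Stokes.le_iff_reflTransGen_rotation⟩,
    fun R i hi => ⟨Stokes.exists_orientedFlip_from_iff R hi, Stokes.exists_orientedFlip_to_iff R hi⟩,
    -- The duality with trees reverses the order, and reflection reverses it back.
    ⟨(Stokes.stokesIsoDual n).trans (Stokes.tamariMirror n).symm⟩,
    fun R R' => ⟨Stokes.exists_isLUB n R R', Stokes.exists_isGLB n R R'⟩,
    (Nat.card_congr (Stokes.binaryTreeEquiv n)).trans (Stokes.card_tamari n)⟩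
  rw [← Stokes.quadOf_binaryTreeEquiv R]
  exact Stokes.isDualTree_quadOf_iff (Stokes.binaryTreeEquiv n R).2
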